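/- All groups are finite, and classes of groups are closed under isomorphism. Let $\pi$ be a set of primes and $\pi'$ the complementary set of primes. Let $\mathfrak S$ and $\mathfrak N$ be the classes of solvable and of nilpotent groups, $\mathfrak G_\pi$ the class of $\pi$-groups, $\mathfrak G_p=\mathfrak G_{\{p\}}$, and $\mathfrak N_\pi$ the class of $\pi$-nilpotent groups, that is, of groups with a normal $\pi'$-subgroup whose quotient is nilpotent. A formation is a non-empty class $\mathfrak F$ of groups closed under homomorphic images and such that $G/M,\,G/N\in\mathfrak F$ implies $G/(M\cap N)\in\mathfrak F$. The residual $G^{\mathfrak F}$ is the smallest normal subgroup $N$ of $G$ with $G/N\in\mathfrak F$. For a class $\mathfrak X$ of groups, $\mathfrak X\circ\mathfrak F$ is the class of all groups $G$ with $G^{\mathfrak F}\in\mathfrak X$, $\mathrm{Int}_{\mathfrak X}(G)$ is the intersection of all $\mathfrak X$-maximal subgroups of $G$ (the maximal elements of the set of subgroups of $G$ that belong to $\mathfrak X$), and $\mathrm{Crit}_{\mathtt S}(\mathfrak X)$ is the class of all groups that are not in $\mathfrak X$ but all of whose proper subgroups are in $\mathfrak X$. Let $\mathcal N_{\pi'\mathfrak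 F}(G)=\bigcap_{H\le G}N_G\bigl(H^{\mathfrak F}O_{\pi'}(G)\bigr)$, where $O_{\pi'}(G)$ is the largest normal $\pi'$-subgroup of $G$. Put $\mathcal N^0_{\pi'\mathfrak F}(G)=1$ and $\mathcal N^{i}_{\pi'\mathfrak F}(G)/\mathcal N^{i-1}_{\pi'\mathfrak F}(G)=\mathcal N_{\pi'\mathfrak F}\bigl(G/\mathcal N^{i-1}_{\pi'\mathfrak F}(G)\bigr)$ for $i\ge1$, and let $\mathcal N^\infty_{\pi'\mathfrak F}(G)$ be the terminal term of this ascending series. For a class $\mathfrak X$ of groups, a $G$-chief factor $L/K$ is $\mathfrak X$-central in $G$ if $(L/K)\rtimes(G/C_G(L/K))\in\mathfrak X$. Let $Z_{\pi\mathfrak X}(G)$ be the product of all normal subgroups $N$ of $G$ such that every $G$-chief factor $L/K$ with $L\le N$ and order divisible by at least one prime in $\pi$ is $\mathfrak X$-central in $G$. Theorem. Let $\mathfrak F$ be a formation that is closed under taking subgroups, and let $\pi$ be a set of primes. Then the following statements are equivalent: (1) $\mathcal N^\infty_{\pi'\mathfrak F}(G)=\mathrm{Int}_{\mathfrak N_\pi\circ\mathfrak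 F}(G)$ for every $G\in\mathfrak S$. (2) $Z_{\pi(\mathfrak N\circ\mathfrak F)}(G)=\mathrm{Int}_{\mathfrak N_\pi\circ\mathfrak F}(G)$ for every $G\in\mathfrak S$. (3) For every $p\in\pi$, $\mathrm{Crit}_{\mathtt S}(\mathfrak G_p\circ\mathfrak F)\cap\mathfrak S\subseteq\mathfrak N_\pi\circ\mathfrak F$. -/

import Mathlib

universe u

/-- A class of finite groups (in the universe `u`), closed under isomorphism. -/
structure GroupClass where
  /-- Membership of a group in the class. -/
  Mem : ∀ (G : Type u) [Group G], Prop
  finite_of_mem : ∀ (G : Type u) [Group G], Mem G → Finite G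
  mem_of_mulEquiv : ∀ (G H : Type u) [Group G] [Group H], (G ≃* H) → Mem G → Mem H

namespace GroupClass

/-- The class of all finite `π`-groups, for a set `π` of primes. -/
def piGroups (π : Set Nat.Primes) : GroupClass.{u} where
  Mem G _ := Finite G ∧ ∀ p : Nat.Primes, (p : ℕ) ∣ Nat.card G → p ∈ π
  finite_of_mem _ _ h := h.1
  mem_of_mulEquiv G H _ _ e h :=
    ⟨(Equiv.finite_iff e.toEquiv).1 h.1, fun p hp => h.2 p (by rwa [Nat.card_congr e.toEquiv])⟩

/-- The class of all finite solvable groups. -/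
def solvable : GroupClass.{u} where
  Mem G _ := Finite G ∧ Group.IsSolvable G
  finite_of_mem _ _ h := h.1
  mem_of_mulEquiv _ _ _ _ e h :=
    ⟨(Equiv.finite_iff e.toEquiv).1 h.1,
      haveI := h.2
      Group.isSolvable_of_surjective (f := e.toMonoidHom) e.surjective⟩

/-- The class of all finite nilpotent groups. -/
def nilpotent : GroupClass.{u} where
  Mem G _ := Finite G ∧ Group.IsNilpotent G
  finite_of_mem _ _ h := h.1
  mem_of_mulEquiv _ _ _ _ e h :=
    ⟨(Equiv.finite_iff e.toEquiv).1 h.1,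
      haveI := h.2
      Group.nilpotent_of_mulEquiv e⟩

/-- An isomorphism `G ≃* H` induces an isomorphism of `G` modulo the preimage of `N` with `H ⧸ N`. -/
theorem nonempty_quotient_comap_mulEquiv {G H : Type u} [Group G] [Group H] (e : G ≃* H)
    (N : Subgroup H) [N.Normal] : Nonempty (G ⧸ N.comap e.toMonoidHom ≃* H ⧸ N) :=
  ⟨QuotientGroup.congr _ _ e (Subgroup.map_comap_eq_self_of_surjective e.surjective N)⟩

/-- The class of all finite `π`-nilpotent groups: extensions of a normal `π'`-subgroup by a
nilpotent group. -/
def piNilpotent (π : Set Nat.Primes) : GroupClass.{u} where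
  Mem G _ := Finite G ∧ ∃ (N : Subgroup G) (_ : N.Normal),
    (piGroups πᶜ).Mem N ∧ nilpotent.Mem (G ⧸ N)
  finite_of_mem _ _ h := h.1
  mem_of_mulEquiv G H _ _ e h := by
    obtain ⟨hG, N, hN, hN1, hN2⟩ := h
    have hM : (N.map e.toMonoidHom).Normal := hN.map _ e.surjective
    exact ⟨(Equiv.finite_iff e.toEquiv).1 hG, N.map e.toMonoidHom, hM,
      (piGroups πᶜ).mem_of_mulEquiv _ _ (e.subgroupMap N) hN1,
      nilpotent.mem_of_mulEquiv _ _ (QuotientGroup.congr N _ e rfl) hN2⟩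

variable (𝔛 𝔉 : GroupClass.{u}) (π : Set Nat.Primes)

/-- A formation: a non-empty class of groups closed under homomorphic images and subdirect
products. -/
structure IsFormation : Prop where
  nonempty : ∃ (G : Type u) (_ : Group G), 𝔉.Mem G
  mem_of_surjective : ∀ (G H : Type u) [Group G] [Group H] (f : G →* H),
    Function.Surjective f → 𝔉.Mem G → 𝔉.Mem H
  mem_quotient_inf : ∀ (G : Type u) [Group G] (M N : Subgroup G) [M.Normal] [N.Normal],
    𝔉.Mem (G ⧸ M) → 𝔉.Mem (G ⧸ N) → 𝔉.Mem (G ⧸ (M ⊓ N))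

/-- The class is closed under taking subgroups. -/
def IsSubgroupClosed : Prop :=
  ∀ (G : Type u) [Group G] (H : Subgroup G), 𝔉.Mem G → 𝔉.Mem H

/-- The `𝔉`-residual of `G`: the intersection of all normal subgroups `N` with `G ⧸ N ∈ 𝔉`.
If `𝔉` is a formation and `G` is finite, it is the smallest such `N`. -/
def residual (G : Type u) [Group G] : Subgroup G :=
  sInf {N : Subgroup G | ∃ _ : N.Normal, 𝔉.Mem (G ⧸ N)}

theorem residual_le_comap {G H : Type u} [Group G] [Group H] (e : G ≃* H) :
    𝔉.residual G ≤ (𝔉.residual H).comap e.toMonoidHom := by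
  intro x hx
  simp only [residual, Subgroup.mem_comap, Subgroup.mem_sInf, Set.mem_ofPred_eq] at hx ⊢
  rintro N ⟨hN, hNF⟩
  exact hx (N.comap e.toMonoidHom)
    ⟨inferInstance, 𝔉.mem_of_mulEquiv _ _ (nonempty_quotient_comap_mulEquiv e N).some.symm hNF⟩

theorem residual_map {G H : Type u} [Group G] [Group H] (e : G ≃* H) :
    (𝔉.residual G).map e.toMonoidHom = 𝔉.residual H := by
  apply le_antisymm
  · exact Subgroup.map_le_iff_le_comap.2 (𝔉.residual_le_comap e)
  · intro y hy
    exact ⟨e.symm y, 𝔉.residual_le_comap e.symm hy, e.apply_symm_apply y⟩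

/-- The formation product `𝔛 ∘ 𝔉`: all finite groups whose `𝔉`-residual belongs to `𝔛`. -/
def formationProduct : GroupClass.{u} where
  Mem G _ := Finite G ∧ 𝔛.Mem (𝔉.residual G)
  finite_of_mem _ _ h := h.1
  mem_of_mulEquiv G H _ _ e h := by
    refine ⟨(Equiv.finite_iff e.toEquiv).1 h.1, ?_⟩
    rw [← 𝔉.residual_map e]
    exact 𝔛.mem_of_mulEquiv _ _ (e.subgroupMap (𝔉.residual G)) h.2

/-- `O_π(G)`: the product of all normal `π`-subgroups of `G`. -/
def piRadical (G : Type u) [Group G] : Subgroup G :=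
  sSup {N : Subgroup G | N.Normal ∧ (piGroups π).Mem N}

/-- The `𝔉`-residual of a subgroup `H` of `G`, as a subgroup of `G`. -/
def subgroupResidual {G : Type u} [Group G] (H : Subgroup G) : Subgroup G :=
  (𝔉.residual H).map H.subtype

/-- The `π𝔉`-norm of `G`: the intersection of the normalizers of the products `H^𝔉 O_π(G)`, where
`H` runs over all subgroups of `G`. -/
def piNorm (G : Type u) [Group G] : Subgroup G :=
  ⨅ H : Subgroup G, Subgroup.normalizer (𝔉.subgroupResidual H ⊔ piRadical π G : Subgroup G)

theorem piRadical_map_conj {G : Type u} [Group G] (g : G) :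
    (piRadical π G).map (MulAut.conj g : G →* G) = piRadical π G := by
  have key : ∀ N ∈ {N : Subgroup G | N.Normal ∧ (piGroups π).Mem N},
      N.map (MulAut.conj g : G →* G) = N := by
    rintro N ⟨hN, -⟩
    exact Subgroup.mem_normalizer_iff_map_conj_eq.1 (by rw [Subgroup.normalizer_eq_top]; trivial)
  rw [piRadical, sSup_eq_iSup, Subgroup.map_iSup]
  refine iSup_congr fun N => ?_
  rw [Subgroup.map_iSup]
  exact iSup_congr fun hN => key N hN

theorem subgroupResidual_map_conj {G : Type u} [Group G] (g : G) (H : Subgroup G) :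
    (𝔉.subgroupResidual H).map (MulAut.conj g : G →* G) =
      𝔉.subgroupResidual (H.map (MulAut.conj g : G →* G)) := by
  have h : (𝔉.residual H).map ((MulAut.conj g).subgroupMap H).toMonoidHom =
      𝔉.residual (H.map (MulAut.conj g : G →* G)) :=
    𝔉.residual_map ((MulAut.conj g).subgroupMap H)
  rw [subgroupResidual, subgroupResidual, ← h, Subgroup.map_map, Subgroup.map_map]
  rfl

instance piNorm_normal (G : Type u) [Group G] : (piNorm 𝔉 π G).Normal := by
  refine ⟨fun x hx g => ?_⟩
  have key : ∀ H : Subgroup G,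
      (𝔉.subgroupResidual H ⊔ piRadical π G).map (MulAut.conj g : G →* G) =
        𝔉.subgroupResidual (H.map (MulAut.conj g : G →* G)) ⊔ piRadical π G := fun H => by
    rw [Subgroup.map_sup, subgroupResidual_map_conj, piRadical_map_conj]
  simp only [piNorm, Subgroup.mem_iInf] at hx ⊢
  intro H
  obtain ⟨K, rfl⟩ : ∃ K : Subgroup G, K.map (MulAut.conj g : G →* G) = H :=
    ⟨_, Subgroup.map_comap_eq_self_of_surjective (MulAut.conj g).surjective H⟩
  rw [← key, Subgroup.mem_normalizer_iff_map_conj_eq]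
  have h := Subgroup.mem_normalizer_iff_map_conj_eq.1 (hx K)
  conv_rhs => rw [← h]
  rw [Subgroup.map_map, Subgroup.map_map]
  congr 1
  ext y
  simp [mul_assoc]

/-- The upper `π𝔉`-norm series: the term of index `0` is trivial, and the term of index `i + 1`
is the preimage in `G` of the `π𝔉`-norm of `G` modulo the term of index `i`. -/
def piNormSeries (G : Type u) [Group G] : ℕ → {N : Subgroup G // N.Normal}
  | 0 => ⟨⊥, inferInstance⟩
  | i + 1 =>
    haveI := (piNormSeries G i).2
    ⟨(piNorm 𝔉 π (G ⧸ (piNormSeries G i).1)).comap (QuotientGroup.mk' (piNormSeries G i).1),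
      inferInstance⟩

/-- The terminal term of the (ascending) upper `π𝔉`-norm series of a finite group `G`. -/
def piNormInfty (G : Type u) [Group G] : Subgroup G :=
  ⨆ i : ℕ, (piNormSeries 𝔉 π G i).1

/-- The intersection of all `𝔛`-maximal subgroups of `G`. -/
def intMaximal (G : Type u) [Group G] : Subgroup G :=
  sInf {U : Subgroup G | Maximal (fun V : Subgroup G => 𝔛.Mem V) U}

/-- `L / K` is a `G`-chief factor. -/
structure IsChiefFactor {G : Type u} [Group G] (K L : Subgroup G) : Prop where
  normal_left : K.Normal
  normal_right : L.Normal
  lt : K < L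
  eq_or_eq : ∀ M : Subgroup G, M.Normal → K ≤ M → M ≤ L → M = K ∨ M = L

/-- `L / K`, realised as a subgroup of `G ⧸ K`. -/
abbrev factor {G : Type u} [Group G] (K L : Subgroup G) [K.Normal] : Subgroup (G ⧸ K) :=
  L.map (QuotientGroup.mk' K)

/-- The conjugation action of `G` on `L / K`; its kernel is `C_G(L / K)`. -/
def factorAction {G : Type u} [Group G] (K L : Subgroup G) [K.Normal] [L.Normal] :
    G →* MulAut (factor K L) :=
  haveI : (factor K L).Normal := Subgroup.Normal.map ‹_› _ (QuotientGroup.mk'_surjective K)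
  MulAut.conjNormal.comp (QuotientGroup.mk' K)

/-- The semidirect product of `L / K` with `G ⧸ C_G(L / K)` belongs to `𝔉`. -/
def IsCentralFactor {G : Type u} [Group G] (K L : Subgroup G) [K.Normal] [L.Normal] : Prop :=
  𝔉.Mem (factor K L ⋊[QuotientGroup.kerLift (factorAction K L)] (G ⧸ (factorAction K L).ker))

/-- A normal subgroup `N` of `G` is `π𝔉`-hypercentral in `G` if every `G`-chief factor below `N`
whose order is divisible by at least one prime in `π` is `𝔉`-central in `G`. -/
structure IsPiHypercentral {G : Type u} [Group G] (N : Subgroup G) : Prop where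
  normal : N.Normal
  central : ∀ (K L : Subgroup G) [K.Normal] [L.Normal], IsChiefFactor K L → L ≤ N →
    (∃ p ∈ π, (p : ℕ) ∣ Nat.card (factor K L)) → 𝔉.IsCentralFactor K L

/-- The `π𝔉`-hypercentre of `G`: the product of all `π𝔉`-hypercentral normal subgroups. -/
def piHypercentre (G : Type u) [Group G] : Subgroup G :=
  sSup {N : Subgroup G | IsPiHypercentral 𝔉 π N}

/-- `G` is `S`-critical for `𝔛`: the finite group `G` does not belong to `𝔛`, but all its proper
subgroups do. -/
def IsSCritical (G : Type u) [Group G] : Prop :=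
  Finite G ∧ ¬ 𝔛.Mem G ∧ ∀ H : Subgroup G, H < ⊤ → 𝔛.Mem H

/-- For every `p ∈ π`, every solvable group that is `S`-critical for `𝔊_p ∘ 𝔉` belongs to
`𝔑_π ∘ 𝔉`. -/
def BoundaryConditionIIISolvable : Prop :=
  ∀ p ∈ π, ∀ (G : Type u) [Group G],
    IsSCritical (formationProduct (piGroups {p}) 𝔉) G → solvable.Mem G →
      (formationProduct (piNilpotent π) 𝔉).Mem G

end GroupClass

/-!
For solvable `G` one always has `Z_{π(𝔑∘𝔉)}(G) ≤ N^∞_{π'𝔉}(G) ≤ Int_{𝔑_π∘𝔉}(G)`: a `π`-hypercentral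
chief factor is centralised by the residual, hence absorbed by the norm series, and adjoining the
norm to a subgroup with `π`-nilpotent residual keeps the residual `π`-nilpotent. So (2) implies (1).

Under (3) the intersection `I` of the `𝔑_π ∘ 𝔉`-maximal subgroups is itself hypercentral. If the
residual acted on a `p`-chief factor below `I` other than as a `p`-group, a minimal subgroup doing
so would be a Frattini extension of a critical group, hence in `𝔑_π ∘ 𝔉`. A maximal subgroup in that
class above it contains `I`, which forces the action to be by a `p`-group after all.

If (3) fails, a critical group `H ∉ 𝔑_π ∘ 𝔉` of minimal order has a unique minimal normal subgroup,
of order prime to `p`, hence a faithful irreducible module `V` over the field with `p` elements. In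
`V ⋊ H` every subgroup in `𝔑_π ∘ 𝔉` stays in that class after adjoining `V`, so `V` lies in the
intersection; but `V` does not lie in `N^∞`, because `H^𝔉 ≠ 1` does not centralise `V`.
-/

/-! ### Residuals of formations -/

namespace GroupClass

section Residual

variable {𝔉 : GroupClass.{u}} {G H : Type u} [Group G] [Group H]

instance residual_normal : (𝔉.residual G).Normal where
  conj_mem x hx g := by
    rw [residual, Subgroup.mem_sInf] at hx ⊢
    rintro N ⟨hN, hNF⟩
    exact hN.conj_mem x (hx N ⟨hN, hNF⟩) g

theorem residual_le_of_mem {N : Subgroup G} [hN : N.Normal] (h : 𝔉.Mem (G ⧸ N)) :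
    𝔉.residual G ≤ N :=
  sInf_le ⟨hN, h⟩

theorem residual_le_ker_of_surjective (f : G →* H) (hf : Function.Surjective f) (h : 𝔉.Mem H) :
    𝔉.residual G ≤ f.ker :=
  residual_le_of_mem
    (𝔉.mem_of_mulEquiv _ _ (QuotientGroup.quotientKerEquivOfSurjective f hf).symm h)

theorem residual_le_ker (hS : 𝔉.IsSubgroupClosed) (f : G →* H) (h : 𝔉.Mem H) :
    𝔉.residual G ≤ f.ker := by
  rw [← f.ker_rangeRestrict]
  exact residual_le_ker_of_surjective _ f.rangeRestrict_surjective (hS H f.range h)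

theorem IsFormation.mem_of_subsingleton (h𝔉 : 𝔉.IsFormation) [Subsingleton G] : 𝔉.Mem G := by
  obtain ⟨E, _, hE⟩ := h𝔉.nonempty
  exact h𝔉.mem_of_surjective E G 1 (fun x => ⟨1, Subsingleton.elim _ _⟩) hE

theorem IsFormation.mem_quotient_mono (h𝔉 : 𝔉.IsFormation) {M N : Subgroup G} [M.Normal]
    [N.Normal] (h : M ≤ N) (hM : 𝔉.Mem (G ⧸ M)) : 𝔉.Mem (G ⧸ N) :=
  h𝔉.mem_of_surjective _ _ (QuotientGroup.map M N (MonoidHom.id G) h)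
    (QuotientGroup.map_surjective_of_surjective _ _ _ QuotientGroup.mk_surjective _) hM

theorem IsFormation.mem_quotient_residual (h𝔉 : 𝔉.IsFormation) [Finite G] :
    𝔉.Mem (G ⧸ 𝔉.residual G) := by
  have : Subsingleton (G ⧸ (⊤ : Subgroup G)) := QuotientGroup.subsingleton_quotient_top
  obtain ⟨N, ⟨_, hNF⟩, hmin⟩ :=
    (Set.toFinite {N : Subgroup G | ∃ _ : N.Normal, 𝔉.Mem (G ⧸ N)}).exists_minimal
      ⟨⊤, inferInstance, h𝔉.mem_of_subsingleton⟩
  refine h𝔉.mem_quotient_mono (le_sInf ?_) hNF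
  rintro M ⟨_, hMF⟩
  exact (hmin ⟨inferInstance, h𝔉.mem_quotient_inf G M N hMF hNF⟩ inf_le_right).trans inf_le_left

theorem IsFormation.mem_quotient_iff (h𝔉 : 𝔉.IsFormation) [Finite G] {N : Subgroup G} [N.Normal] :
    𝔉.Mem (G ⧸ N) ↔ 𝔉.residual G ≤ N :=
  ⟨residual_le_of_mem, fun h => h𝔉.mem_quotient_mono h h𝔉.mem_quotient_residual⟩

theorem IsFormation.mem_iff_residual_eq_bot (h𝔉 : 𝔉.IsFormation) [Finite G] :
    𝔉.Mem G ↔ 𝔉.residual G = ⊥ := by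
  rw [← le_bot_iff, ← h𝔉.mem_quotient_iff]
  exact ⟨𝔉.mem_of_mulEquiv _ _ QuotientGroup.quotientBot.symm,
    𝔉.mem_of_mulEquiv _ _ QuotientGroup.quotientBot⟩

theorem IsFormation.map_residual_le (h𝔉 : 𝔉.IsFormation) (hS : 𝔉.IsSubgroupClosed) [Finite H]
    (f : G →* H) : (𝔉.residual G).map f ≤ 𝔉.residual H := by
  rw [Subgroup.map_le_iff_le_comap, ← QuotientGroup.ker_mk' (𝔉.residual H), MonoidHom.comap_ker]
  exact residual_le_ker hS _ h𝔉.mem_quotient_residual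

theorem IsFormation.map_residual (h𝔉 : 𝔉.IsFormation) [Finite G] (f : G →* H)
    (hf : Function.Surjective f) : (𝔉.residual G).map f = 𝔉.residual H := by
  have : Finite H := Finite.of_surjective f hf
  apply le_antisymm
  · rw [Subgroup.map_le_iff_le_comap, ← QuotientGroup.ker_mk' (𝔉.residual H), MonoidHom.comap_ker]
    exact residual_le_ker_of_surjective _ ((QuotientGroup.mk'_surjective _).comp hf)
      h𝔉.mem_quotient_residual
  · have : ((𝔉.residual G).map f).Normal := Subgroup.Normal.map inferInstance f hf
    exact residual_le_of_mem (h𝔉.mem_of_surjective _ _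
      (QuotientGroup.map (𝔉.residual G) _ f (Subgroup.le_comap_map _ _))
      (QuotientGroup.map_surjective_of_surjective _ _ _ (QuotientGroup.mk_surjective.comp hf) _)
      h𝔉.mem_quotient_residual)

theorem IsFormation.subgroupResidual_range (h𝔉 : 𝔉.IsFormation) [Finite G] (f : G →* H) :
    𝔉.subgroupResidual f.range = (𝔉.residual G).map f := by
  rw [subgroupResidual, ← h𝔉.map_residual f.rangeRestrict f.rangeRestrict_surjective,
    Subgroup.map_map]
  rfl

theorem IsFormation.subgroupResidual_map (h𝔉 : 𝔉.IsFormation) [Finite G] (f : G →* H)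
    (U : Subgroup G) : 𝔉.subgroupResidual (U.map f) = (𝔉.subgroupResidual U).map f := by
  have h := h𝔉.subgroupResidual_range (f.comp U.subtype)
  rwa [← Subgroup.map_map, MonoidHom.range_comp, Subgroup.range_subtype] at h

theorem IsFormation.subgroupResidual_top (h𝔉 : 𝔉.IsFormation) [Finite G] :
    𝔉.subgroupResidual (⊤ : Subgroup G) = 𝔉.residual G := by
  have h := h𝔉.subgroupResidual_range (MonoidHom.id G)
  rwa [MonoidHom.range_eq_top.2 Function.surjective_id, Subgroup.map_id] at h

theorem subgroupResidual_le (U : Subgroup G) : 𝔉.subgroupResidual U ≤ U :=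
  Subgroup.map_subtype_le _

theorem IsFormation.subgroupResidual_mono (h𝔉 : 𝔉.IsFormation) (hS : 𝔉.IsSubgroupClosed) [Finite G]
    {U W : Subgroup G} (h : U ≤ W) : 𝔉.subgroupResidual U ≤ 𝔉.subgroupResidual W := by
  have hUW := Subgroup.map_mono (f := W.subtype) (h𝔉.map_residual_le hS (Subgroup.inclusion h))
  rwa [Subgroup.map_map] at hUW

theorem IsFormation.subgroupResidual_le_residual (h𝔉 : 𝔉.IsFormation) (hS : 𝔉.IsSubgroupClosed)
    [Finite G] (U : Subgroup G) : 𝔉.subgroupResidual U ≤ 𝔉.residual G :=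
  h𝔉.map_residual_le hS U.subtype

theorem IsFormation.map_subgroupResidual_eq_of_sup_ker_eq_top (h𝔉 : 𝔉.IsFormation) [Finite G]
    {f : G →* H} {M : Subgroup G} (h : M ⊔ f.ker = ⊤) :
    (𝔉.subgroupResidual M).map f = (𝔉.residual G).map f := by
  rw [← h𝔉.subgroupResidual_map, ← h𝔉.subgroupResidual_top, ← h𝔉.subgroupResidual_map,
    (Subgroup.map_eq_map_iff (f := f) (H := M) (K := ⊤)).2 (by rw [h, top_sup_eq])]

end Residual

theorem isFormation_nilpotent : nilpotent.{u}.IsFormation where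
  nonempty := ⟨PUnit, inferInstance, inferInstance, inferInstance⟩
  mem_of_surjective _ _ _ _ f hf h :=
    have := h.1
    have := h.2
    ⟨Finite.of_surjective f hf, Group.nilpotent_of_surjective f hf⟩
  mem_quotient_inf G _ M N _ _ hM hN := by
    obtain ⟨_, _⟩ := hM
    obtain ⟨_, _⟩ := hN
    let f : G →* (G ⧸ M) × (G ⧸ N) := (QuotientGroup.mk' M).prod (QuotientGroup.mk' N)
    have hf : f.ker = M ⊓ N := by
      rw [MonoidHom.ker_prod, QuotientGroup.ker_mk', QuotientGroup.ker_mk']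
    exact nilpotent.mem_of_mulEquiv _ _
      ((QuotientGroup.quotientKerEquivRange f).symm.trans (QuotientGroup.quotientMulEquivOfEq hf))
      ⟨inferInstance, inferInstance⟩

end GroupClass

/-! ### `p`-groups and `p`-nilpotent subgroups -/

section PNilpotent

variable {G Y Z : Type*} [Group G] [Group Y] [Group Z] {p : ℕ} {R S : Subgroup G}

theorem isPGroup_map_iff {f : G →* Y} :
    IsPGroup p (R.map f) ↔ ∀ x ∈ R, ∃ k, x ^ p ^ k ∈ f.ker := by
  simp only [IsPGroup, Subtype.forall, Subgroup.mem_map, forall_exists_index, and_imp,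
    forall_apply_eq_imp_iff₂, Subtype.ext_iff, SubmonoidClass.mk_pow, OneMemClass.coe_one,
    MonoidHom.mem_ker, map_pow]

theorem isPGroup_iff_of_injective {f : G →* Y} (hf : Function.Injective f) :
    IsPGroup p (R.map f) ↔ IsPGroup p R :=
  ⟨fun h => h.of_equiv (R.equivMapOfInjective f hf).symm, fun h => h.map f⟩

theorem isPGroup_of_map_of_map {f : G →* Y} {g : G →* Z} (hf : IsPGroup p (R.map f))
    (hg : IsPGroup p (R.map g)) (hfg : f.ker ⊓ g.ker = ⊥) : IsPGroup p R := by
  rintro ⟨x, hx⟩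
  obtain ⟨k, hk⟩ := isPGroup_map_iff.1 hf x hx
  obtain ⟨m, hm⟩ := isPGroup_map_iff.1 hg x hx
  have hfgx : x ^ p ^ (k + m) ∈ f.ker ⊓ g.ker :=
    ⟨by rw [pow_add, pow_mul]; exact Subgroup.pow_mem _ hk _,
      by rw [pow_add, mul_comm, pow_mul]; exact Subgroup.pow_mem _ hm _⟩
  rw [hfg, Subgroup.mem_bot] at hfgx
  exact ⟨k + m, Subtype.ext hfgx⟩

theorem coprime_orderOf_of_pow {x : G} {m : ℕ} (hm : m.Coprime p)
    (h : (orderOf (x ^ m)).Coprime p) : (orderOf x).Coprime p :=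
  (hm.mul_left h).coprime_dvd_left
    (orderOf_dvd_of_pow_eq_one (by rw [pow_mul, pow_orderOf_eq_one]))

theorem coprime_orderOf_map (f : G →* Y) {x : G} (h : (orderOf x).Coprime p) :
    (orderOf (f x)).Coprime p :=
  h.coprime_dvd_left (orderOf_map_dvd f x)

theorem exists_coprime_orderOf_pow [Finite G] [hp : Fact p.Prime] (x : G) :
    ∃ a : ℕ, (orderOf (x ^ p ^ a)).Coprime p := by
  refine ⟨(orderOf x).factorization p, ?_⟩
  rw [orderOf_pow_of_dvd (pow_pos hp.out.pos _).ne' (Nat.ordProj_dvd _ _)]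
  exact (Nat.coprime_ordCompl hp.out (orderOf_pos x).ne').symm

theorem exists_coprime_orderOf_lift [Finite G] [Fact p.Prime] (f : G →* Y) {x : G} (hx : x ∈ R)
    (h : (orderOf (f x)).Coprime p) : ∃ y ∈ R, f y = f x ∧ (orderOf y).Coprime p := by
  obtain ⟨a, ha⟩ := exists_coprime_orderOf_pow (p := p) x
  obtain ⟨t, ht⟩ := exists_pow_eq_self_of_coprime (x := f x) (n := p ^ a) (h.symm.pow_left a)
  refine ⟨(x ^ p ^ a) ^ t, R.pow_mem (R.pow_mem hx _) _, ?_,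
    ha.coprime_dvd_left (orderOf_pow_dvd t)⟩
  rw [map_pow, map_pow, ht]

theorem eq_one_of_isPGroup_of_coprime (h : IsPGroup p R) {x : G} (hx : x ∈ R)
    (hxp : (orderOf x).Coprime p) : x = 1 := by
  obtain ⟨k, hk⟩ := h ⟨x, hx⟩
  exact orderOf_eq_one_iff.1 (Nat.eq_one_of_dvd_coprimes (hxp.symm.pow_left k)
    (orderOf_dvd_of_pow_eq_one (congrArg Subtype.val hk)) dvd_rfl)

theorem coprime_card_iff_forall_orderOf [Finite G] [hp : Fact p.Prime] :
    (Nat.card R).Coprime p ↔ ∀ x ∈ R, (orderOf x).Coprime p := by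
  refine ⟨fun h x hx => h.coprime_dvd_left (R.orderOf_dvd_natCard hx), fun h => ?_⟩
  refine Nat.Coprime.symm (hp.out.coprime_iff_not_dvd.2 fun hd => ?_)
  obtain ⟨x, hx⟩ := exists_prime_orderOf_dvd_card' p hd
  have hxp := h x x.2
  rw [Subgroup.orderOf_coe, hx, Nat.coprime_self] at hxp
  exact hp.out.ne_one hxp

/-- The subgroup `R` is `p`-nilpotent, in the sense that the elements of `R` of order prime to `p`
are closed under multiplication. For a finite `R` these elements then form its normal
`p`-complement; the elementwise form is easier to transport along homomorphisms. -/
def IsPNilpotent (p : ℕ) (R : Subgroup G) : Prop :=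
  ∀ x ∈ R, ∀ y ∈ R, (orderOf x).Coprime p → (orderOf y).Coprime p → (orderOf (x * y)).Coprime p

namespace IsPNilpotent

theorem mono (h : IsPNilpotent p S) (hRS : R ≤ S) : IsPNilpotent p R :=
  fun x hx y hy => h x (hRS hx) y (hRS hy)

theorem of_isPGroup (h : IsPGroup p R) : IsPNilpotent p R := by
  intro x hx y _ hxp hyp
  rw [eq_one_of_isPGroup_of_coprime h hx hxp, one_mul]
  exact hyp

theorem map_of_ker_le [Finite G] [Fact p.Prime] {f : G →* Y} {g : G →* Z}
    (h : IsPNilpotent p (R.map f)) (hfg : f.ker ≤ g.ker) : IsPNilpotent p (R.map g) := by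
  rintro _ ⟨x, hx, rfl⟩ _ ⟨y, hy, rfl⟩ hxp hyp
  obtain ⟨x', hx', hxe, hxp'⟩ := exists_coprime_orderOf_lift g hx hxp
  obtain ⟨y', hy', hye, hyp'⟩ := exists_coprime_orderOf_lift g hy hyp
  rw [← hxe, ← hye, ← map_mul]
  have hf := h (f x') ⟨x', hx', rfl⟩ (f y') ⟨y', hy', rfl⟩ (coprime_orderOf_map f hxp')
    (coprime_orderOf_map f hyp')
  rw [← map_mul] at hf
  refine hf.coprime_dvd_left (orderOf_dvd_of_pow_eq_one ?_)
  rw [← map_pow, ← MonoidHom.mem_ker]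
  exact hfg (by rw [MonoidHom.mem_ker, map_pow, pow_orderOf_eq_one])

theorem map [Finite G] [Fact p.Prime] (h : IsPNilpotent p R) (f : G →* Y) :
    IsPNilpotent p (R.map f) := by
  rw [← R.map_id] at h
  exact h.map_of_ker_le (by rw [(MonoidHom.ker_eq_bot_iff _).2 Function.injective_id]; exact bot_le)

theorem of_map_of_coprime_ker {f : G →* Y} (h : IsPNilpotent p (R.map f))
    (hf : (Nat.card f.ker).Coprime p) : IsPNilpotent p R := by
  intro x hx y hy hxp hyp
  have hxy := h (f x) ⟨x, hx, rfl⟩ (f y) ⟨y, hy, rfl⟩ (coprime_orderOf_map f hxp)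
    (coprime_orderOf_map f hyp)
  rw [← map_mul] at hxy
  refine coprime_orderOf_of_pow hxy (hf.coprime_dvd_left (f.ker.orderOf_dvd_natCard ?_))
  rw [MonoidHom.mem_ker, map_pow, pow_orderOf_eq_one]

theorem of_map_of_injective {f : G →* Y} (h : IsPNilpotent p (R.map f))
    (hf : Function.Injective f) : IsPNilpotent p R :=
  h.of_map_of_coprime_ker (by rw [(MonoidHom.ker_eq_bot_iff f).2 hf]; simp)

theorem of_map_of_map {f : G →* Y} {g : G →* Z} (hf : IsPNilpotent p (R.map f))
    (hg : IsPNilpotent p (R.map g)) (hfg : f.ker ⊓ g.ker = ⊥) : IsPNilpotent p R := by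
  intro x hx y hy hxp hyp
  have h₁ := hf (f x) ⟨x, hx, rfl⟩ (f y) ⟨y, hy, rfl⟩ (coprime_orderOf_map f hxp)
    (coprime_orderOf_map f hyp)
  have h₂ := hg (g x) ⟨x, hx, rfl⟩ (g y) ⟨y, hy, rfl⟩ (coprime_orderOf_map g hxp)
    (coprime_orderOf_map g hyp)
  rw [← map_mul] at h₁ h₂
  refine (h₁.mul_left h₂).coprime_dvd_left (orderOf_dvd_of_pow_eq_one ?_)
  rw [← Subgroup.mem_bot, ← hfg, Subgroup.mem_inf, MonoidHom.mem_ker, MonoidHom.mem_ker, map_pow,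
    map_pow]
  exact ⟨by rw [pow_mul, pow_orderOf_eq_one, one_pow],
    by rw [mul_comm, pow_mul, pow_orderOf_eq_one, one_pow]⟩

/-- The normal `p`-complement of a `p`-nilpotent subgroup. -/
def complement (h : IsPNilpotent p R) : Subgroup G where
  carrier := {x | x ∈ R ∧ (orderOf x).Coprime p}
  one_mem' := ⟨R.one_mem, by simp⟩
  mul_mem' hx hy := ⟨R.mul_mem hx.1 hy.1, h _ hx.1 _ hy.1 hx.2 hy.2⟩
  inv_mem' hx := ⟨R.inv_mem hx.1, by simpa using hx.2⟩

instance complement_normal (h : IsPNilpotent p R) [hR : R.Normal] : h.complement.Normal :=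
  ⟨fun x hx g => ⟨hR.conj_mem x hx.1 g, coprime_orderOf_map (MulAut.conj g).toMonoidHom hx.2⟩⟩

theorem isPGroup_map_complement [Finite G] [Fact p.Prime] (h : IsPNilpotent p R) [R.Normal] :
    IsPGroup p (R.map (QuotientGroup.mk' h.complement)) := by
  refine isPGroup_map_iff.2 fun x hx => ?_
  obtain ⟨a, ha⟩ := exists_coprime_orderOf_pow (p := p) x
  exact ⟨a, by rw [QuotientGroup.ker_mk']; exact ⟨R.pow_mem hx _, ha⟩⟩

theorem coprime_card_complement [Finite G] [Fact p.Prime] (h : IsPNilpotent p R) :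
    (Nat.card h.complement).Coprime p :=
  coprime_card_iff_forall_orderOf.2 fun _ hx => hx.2

theorem top_of_isNilpotent [Finite G] [hp : Fact p.Prime] [hG : Group.IsNilpotent G] :
    IsPNilpotent p (⊤ : Subgroup G) := by
  by_cases hd : p ∣ Nat.card G
  · obtain ⟨e⟩ := ((Group.isNilpotent_of_finite_tfae (G := G)).out 0 4).1 hG
    let P : Sylow p G := default
    let q : (Nat.card G).primeFactors :=
      ⟨p, Nat.mem_primeFactors.2 ⟨hp.out, hd, Nat.card_pos.ne'⟩⟩
    let f : G →* P := (Pi.evalMonoidHom _ P).comp ((Pi.evalMonoidHom _ q).comp e.symm.toMonoidHom)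
    have hf : Function.Surjective f :=
      (Function.surjective_eval P).comp ((Function.surjective_eval q).comp e.symm.surjective)
    have hker : Nat.card f.ker = (P : Subgroup G).index := by
      have hcard := f.ker.card_mul_index
      rw [Subgroup.index_ker, MonoidHom.range_eq_top.2 hf, Subgroup.card_top,
        ← (P : Subgroup G).index_mul_card] at hcard
      exact Nat.eq_of_mul_eq_mul_right Nat.card_pos hcard
    refine (of_isPGroup (P.2.to_subgroup _)).of_map_of_coprime_ker (f := f) ?_
    rw [hker]
    exact (hp.out.coprime_iff_not_dvd.2 P.not_dvd_index).symm
  · exact fun x _ y _ _ _ => (hp.out.coprime_iff_not_dvd.2 hd).symm.coprime_dvd_left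
      (orderOf_dvd_natCard _)

theorem of_isNilpotent [Finite G] [Fact p.Prime] [Group.IsNilpotent R] : IsPNilpotent p R := by
  have h := (top_of_isNilpotent (p := p) (G := R)).map R.subtype
  rwa [← MonoidHom.range_eq_map, Subgroup.range_subtype] at h

end IsPNilpotent

theorem isPNilpotent_map_iff_of_injective [Finite G] [Fact p.Prime] {f : G →* Y}
    (hf : Function.Injective f) : IsPNilpotent p (R.map f) ↔ IsPNilpotent p R :=
  ⟨fun h => h.of_map_of_injective hf, fun h => h.map f⟩

theorem isPNilpotent_top_iff [Finite G] [Fact p.Prime] :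
    IsPNilpotent p (⊤ : Subgroup R) ↔ IsPNilpotent p R := by
  rw [← isPNilpotent_map_iff_of_injective R.subtype_injective, ← MonoidHom.range_eq_map,
    Subgroup.range_subtype]

end PNilpotent

namespace GroupClass

section FormationProduct

variable {𝔉 : GroupClass.{u}} {π : Set Nat.Primes} {p : Nat.Primes} {G : Type u} [Group G]
  {U : Subgroup G}

theorem coprime_card_of_mem_piGroups (h : (piGroups π).Mem U) (hp : p ∉ π) :
    (Nat.card U).Coprime p :=
  (p.2.coprime_iff_not_dvd.2 fun hd => hp (h.2 p hd)).symm

variable [Finite G]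

theorem mem_piGroups_singleton_iff : (piGroups {p}).Mem G ↔ IsPGroup (p : ℕ) G := by
  have : Fact (p : ℕ).Prime := ⟨p.2⟩
  refine (and_iff_right ‹_›).trans ⟨fun h => ?_, fun h q hq => ?_⟩
  · exact IsPGroup.iff_card.2 ⟨_, Nat.eq_prime_pow_of_unique_prime_dvd Nat.card_pos.ne'
      fun {q} hq hqd => congrArg Subtype.val (h ⟨q, hq⟩ hqd)⟩
  · obtain ⟨n, hn⟩ := IsPGroup.iff_card.1 h
    exact Subtype.ext ((Nat.prime_dvd_prime_iff_eq q.2 p.2).1 (q.2.dvd_of_dvd_pow (hn ▸ hq)))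

theorem piNilpotent_mem_iff :
    (piNilpotent π).Mem G ↔ ∀ p ∈ π, IsPNilpotent (p : ℕ) (⊤ : Subgroup G) := by
  have (p : Nat.Primes) : Fact (p : ℕ).Prime := ⟨p.2⟩
  refine ⟨?_, fun h => ?_⟩
  · rintro ⟨-, N, _, hNπ, -, _⟩ p hp
    refine (IsPNilpotent.top_of_isNilpotent.mono le_top).of_map_of_coprime_ker
      (f := QuotientGroup.mk' N) ?_
    rw [QuotientGroup.ker_mk']
    exact coprime_card_of_mem_piGroups hNπ (Set.notMem_compl_iff.2 hp)
  · let N : Subgroup G := ⨅ p : π, (h p p.2).complement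
    have : N.Normal := Subgroup.normal_iInf_normal fun p => (h p p.2).complement_normal
    refine ⟨inferInstance, N, this, ⟨inferInstance, fun p hpN hpπ => ?_⟩,
      isFormation_nilpotent.mem_quotient_iff.2 (le_iInf fun p => residual_le_of_mem ?_)⟩
    · have hN : N ≤ (h p hpπ).complement := iInf_le (fun p : π => (h p p.2).complement) ⟨p, hpπ⟩
      exact p.2.coprime_iff_not_dvd.1 (h p hpπ).coprime_card_complement.symm
        (hpN.trans (Subgroup.card_dvd_of_le hN))
    · have hR := (h p p.2).isPGroup_map_complement
      rw [Subgroup.map_top_of_surjective _ (QuotientGroup.mk'_surjective _)] at hR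
      exact ⟨inferInstance, (hR.of_equiv Subgroup.topEquiv).isNilpotent⟩

theorem mem_piNilpotent_product_iff :
    (formationProduct (piNilpotent π) 𝔉).Mem G ↔ ∀ p ∈ π, IsPNilpotent (p : ℕ) (𝔉.residual G) := by
  refine ((and_iff_right ‹_›).trans piNilpotent_mem_iff).trans (forall₂_congr fun p _ => ?_)
  have : Fact (p : ℕ).Prime := ⟨p.2⟩
  exact isPNilpotent_top_iff

theorem mem_piNilpotent_product_subgroup_iff :
    (formationProduct (piNilpotent π) 𝔉).Mem U ↔
      ∀ p ∈ π, IsPNilpotent (p : ℕ) (𝔉.subgroupResidual U) := by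
  refine mem_piNilpotent_product_iff.trans (forall₂_congr fun p _ => ?_)
  have : Fact (p : ℕ).Prime := ⟨p.2⟩
  exact (isPNilpotent_map_iff_of_injective U.subtype_injective).symm

theorem mem_piGroups_singleton_product_iff :
    (formationProduct (piGroups {p}) 𝔉).Mem G ↔ IsPGroup (p : ℕ) (𝔉.residual G) :=
  (and_iff_right ‹_›).trans mem_piGroups_singleton_iff

theorem mem_piGroups_singleton_product_subgroup_iff :
    (formationProduct (piGroups {p}) 𝔉).Mem U ↔ IsPGroup (p : ℕ) (𝔉.subgroupResidual U) :=
  mem_piGroups_singleton_product_iff.trans (isPGroup_iff_of_injective U.subtype_injective).symm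

end FormationProduct

end GroupClass

/-! ### Minimal normal subgroups -/

section MinimalNormal

variable {G : Type*} [Group G] {L N : Subgroup G}

/-- `L` is a minimal normal subgroup: minimal among the nontrivial normal subgroups. -/
def IsMinimalNormal (L : Subgroup G) : Prop :=
  Minimal (fun N : Subgroup G => N.Normal ∧ N ≠ ⊥) L

theorem exists_isMinimalNormal_le [Finite G] [hN : N.Normal] (h : N ≠ ⊥) :
    ∃ L ≤ N, IsMinimalNormal L :=
  (Set.toFinite {N : Subgroup G | N.Normal ∧ N ≠ ⊥}).exists_le_minimal ⟨hN, h⟩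

theorem card_quotient_lt [Finite G] (hN : N ≠ ⊥) : Nat.card (G ⧸ N) < Nat.card G := by
  rw [N.card_eq_card_quotient_mul_card_subgroup]
  exact lt_mul_of_one_lt_right Nat.card_pos (N.one_lt_card_iff_ne_bot.2 hN)

theorem coprime_card_of_isPGroup_of_ne [Finite G] {p q : ℕ} (hp : p.Prime) (hq : q.Prime)
    (hL : IsPGroup q L) (hpq : q ≠ p) : (Nat.card L).Coprime p := by
  have : Fact q.Prime := ⟨hq⟩
  obtain ⟨n, hn⟩ := IsPGroup.iff_card.1 hL
  rw [hn]
  exact ((Nat.coprime_primes hq hp).2 hpq).pow_left n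

namespace IsMinimalNormal

theorem normal (hL : IsMinimalNormal L) : L.Normal :=
  hL.prop.1

theorem ne_bot (hL : IsMinimalNormal L) : L ≠ ⊥ :=
  hL.prop.2

theorem eq_bot_or_eq (hL : IsMinimalNormal L) [hN : N.Normal] (hle : N ≤ L) : N = ⊥ ∨ N = L :=
  or_iff_not_imp_left.2 fun h => hL.eq_of_le ⟨hN, h⟩ hle

theorem inf_eq_bot_or_le (hL : IsMinimalNormal L) [N.Normal] : N ⊓ L = ⊥ ∨ L ≤ N := by
  have := hL.normal
  exact (hL.eq_bot_or_eq inf_le_right).imp_right inf_eq_right.1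

theorem isMulCommutative [Group.IsSolvable G] (hL : IsMinimalNormal L) : IsMulCommutative L := by
  have := hL.normal
  have hlt : ⁅L, L⁆ < L := Group.IsSolvable.commutator_lt_of_ne_bot hL.ne_bot
  have hbot : ⁅L, L⁆ = ⊥ := (hL.eq_bot_or_eq hlt.le).resolve_right hlt.ne
  rw [← Subgroup.le_centralizer_iff_isMulCommutative]
  exact Subgroup.commutator_eq_bot_iff_le_centralizer.1 hbot

theorem exists_isPGroup [Finite G] [Group.IsSolvable G] (hL : IsMinimalNormal L) :
    ∃ q : ℕ, q.Prime ∧ IsPGroup q L := by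
  have := hL.normal
  have := hL.isMulCommutative
  obtain ⟨q, hq, hqL⟩ := Nat.exists_prime_and_dvd (mt Subgroup.card_eq_one.1 hL.ne_bot)
  have : Fact q.Prime := ⟨hq⟩
  let P : Sylow q L := default
  have : (P : Subgroup L).Characteristic := P.characteristic_of_normal inferInstance
  have hP : (P : Subgroup L).map L.subtype ≠ ⊥ := by
    rw [Ne, Subgroup.map_eq_bot_iff_of_injective _ L.subtype_injective]
    exact P.ne_bot_of_dvd_card hqL
  refine ⟨q, hq, ?_⟩
  rw [← (hL.eq_bot_or_eq (Subgroup.map_subtype_le _)).resolve_left hP]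
  exact P.isPGroup'.map _

theorem exists_isCompl [Group.IsSolvable G] (hL : IsMinimalNormal L) (h : ¬ L ≤ frattini G) :
    ∃ M : Subgroup G, IsCompl M L := by
  have := hL.normal
  have := hL.isMulCommutative
  obtain ⟨M, hM, hLM⟩ : ∃ M : Subgroup G, IsCoatom M ∧ ¬ L ≤ M := by
    by_contra! hle
    exact h (le_iInf₂ hle)
  have hsup : M ⊔ L = ⊤ := hM.2 _ (left_lt_sup.2 hLM)
  have hML : (M ⊓ L).Normal := by
    rw [← Subgroup.normalizer_eq_top_iff, eq_top_iff, ← hsup]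
    refine sup_le ?_ ?_
    · exact (le_inf Subgroup.le_normalizer (Subgroup.le_normalizer_of_normal)).trans
        Subgroup.inf_normalizer_le_normalizer_inf
    · exact (Subgroup.le_centralizer L).trans ((Subgroup.centralizer_le inf_le_right).trans
        (Subgroup.centralizer_le_normalizer _))
  refine ⟨M, disjoint_iff.2 ?_, codisjoint_iff.2 hsup⟩
  exact (hL.eq_bot_or_eq inf_le_right).resolve_right fun he => hLM (inf_eq_right.1 he)

theorem commutator_eq_bot_of_isNilpotent {R : Subgroup G} [R.Normal] [hR : Group.IsNilpotent R]
    (hL : IsMinimalNormal L) : ⁅L, R⁆ = ⊥ := by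
  have := hL.normal
  refine (hL.eq_bot_or_eq (Subgroup.commutator_le_left L R)).resolve_right fun h => ?_
  have hLR (n : ℕ) : L ≤ R.lowerCentralSeries n := by
    induction n with
    | zero => simpa [h] using Subgroup.commutator_le_right L R
    | succ n ih => exact h ▸ Subgroup.commutator_mono ih le_rfl
  obtain ⟨n, hn⟩ := (Subgroup.isNilpotent_iff_lowerCentralSeries R).1 hR
  exact hL.ne_bot (le_bot_iff.1 (hn ▸ hLR n))

end IsMinimalNormal

end MinimalNormal

/-! ### Frattini extensions -/

section Frattini

variable {G : Type*} [Group G] [Finite G] {L N R : Subgroup G} [N.Normal] {p q : ℕ}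

theorem exists_normal_isPGroup_sup_eq [hq : Fact q.Prime] [L.Normal] (hN : N ≤ frattini G)
    (hNL : N ≤ L) (hL : IsPGroup q (L.map (QuotientGroup.mk' N))) :
    ∃ Q : Subgroup G, Q.Normal ∧ IsPGroup q Q ∧ Q ⊔ N = L := by
  let P : Sylow q L := default
  let Q : Subgroup G := (P : Subgroup L).map L.subtype
  have hsup : Q ⊔ N = L := by
    refine le_antisymm (sup_le (Subgroup.map_subtype_le _) hNL) (Subgroup.relIndex_eq_one.1 ?_)
    obtain ⟨n, hn⟩ := IsPGroup.iff_card.1 hL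
    have hdvd_pow : (Q ⊔ N).relIndex L ∣ q ^ n := by
      rw [← hn, ← Subgroup.relIndex_ker, QuotientGroup.ker_mk']
      exact Subgroup.relIndex_dvd_of_le_left L le_sup_right
    have hdvd_index : (Q ⊔ N).relIndex L ∣ (P : Subgroup L).index := by
      rw [← Subgroup.comap_map_eq_self_of_injective L.subtype_injective (P : Subgroup L)]
      exact Subgroup.relIndex_dvd_of_le_left L le_sup_left
    exact Nat.eq_one_of_dvd_coprimes
      ((hq.out.coprime_iff_not_dvd.2 P.not_dvd_index).pow_left n) hdvd_pow hdvd_index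
  refine ⟨Q, Subgroup.normalizer_eq_top_iff.1 (frattini_nongenerating ?_), P.isPGroup'.map _, hsup⟩
  rw [eq_top_iff, ← Sylow.normalizer_sup_eq_top P]
  exact sup_le le_sup_left (hsup.ge.trans (sup_le_sup Subgroup.le_normalizer hN))

variable [hp : Fact p.Prime] [Group.IsSolvable G] [R.Normal]

theorem isPNilpotent_of_le_frattini_of_core_eq_bot (hN : N ≤ frattini G)
    (hcore : ∀ K : Subgroup G, K.Normal → (Nat.card K).Coprime p → K = ⊥)
    (h : IsPNilpotent p (R.map (QuotientGroup.mk' N))) : IsPNilpotent p R := by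
  have : (R.map (QuotientGroup.mk' N)).Normal :=
    Subgroup.Normal.map ‹_› _ (QuotientGroup.mk'_surjective N)
  have hbot : h.complement = ⊥ := by
    by_contra hne
    obtain ⟨L, hLle, hL⟩ := exists_isMinimalNormal_le hne
    have := hL.normal
    obtain ⟨q, hq, hLq⟩ := hL.exists_isPGroup
    have : Fact q.Prime := ⟨hq⟩
    have hqp : q ≠ p := by
      rintro rfl
      exact hL.ne_bot ((Subgroup.eq_bot_iff_forall _).2 fun x hx =>
        eq_one_of_isPGroup_of_coprime hLq hx (hLle hx).2)
    have hLN := Subgroup.map_comap_eq_self_of_surjective (QuotientGroup.mk'_surjective N) L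
    obtain ⟨Q, hQ, hQq, hQN⟩ := exists_normal_isPGroup_sup_eq (q := q) hN
      (QuotientGroup.le_comap_mk' N L) (by rwa [hLN])
    rw [hcore Q hQ (coprime_card_of_isPGroup_of_ne hp.out hq hQq hqp), bot_sup_eq] at hQN
    rw [← hQN, QuotientGroup.map_mk'_self] at hLN
    exact hL.ne_bot hLN.symm
  have hfrattini : ∀ x ∈ R, (orderOf x).Coprime p → x ∈ frattini G := fun x hx hxp => by
    refine hN ((QuotientGroup.eq_one_iff x).1 (Subgroup.mem_bot.1 (hbot ▸ ?_)))
    exact ⟨Subgroup.mem_map_of_mem _ hx, coprime_orderOf_map (QuotientGroup.mk' N) hxp⟩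
  have : Group.IsNilpotent (frattini G) := frattini_nilpotent
  exact fun x hx y hy hxp hyp => IsPNilpotent.of_isNilpotent x (hfrattini x hx hxp) y
    (hfrattini y hy hyp) hxp hyp

theorem isPNilpotent_of_le_frattini (hN : N ≤ frattini G)
    (h : IsPNilpotent p (R.map (QuotientGroup.mk' N))) : IsPNilpotent p R := by
  induction hn : Nat.card G using Nat.strong_induction_on generalizing G with
  | _ n ih =>
  by_cases hcore : ∀ K : Subgroup G, K.Normal → (Nat.card K).Coprime p → K = ⊥
  · exact isPNilpotent_of_le_frattini_of_core_eq_bot hN hcore h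
  push Not at hcore
  obtain ⟨K, hK, hKp, hK1⟩ := hcore
  have hKsurj := QuotientGroup.mk'_surjective K
  have : (N.map (QuotientGroup.mk' K)).Normal := Subgroup.Normal.map ‹_› _ hKsurj
  have : (R.map (QuotientGroup.mk' K)).Normal := Subgroup.Normal.map ‹_› _ hKsurj
  refine IsPNilpotent.of_map_of_coprime_ker (f := QuotientGroup.mk' K)
    (ih _ (hn ▸ card_quotient_lt hK1) (N := N.map (QuotientGroup.mk' K)) ?_ ?_ rfl)
    (by rwa [QuotientGroup.ker_mk'])
  · exact Subgroup.map_le_iff_le_comap.2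
      (hN.trans (frattini_le_comap_frattini_of_surjective hKsurj))
  · rw [Subgroup.map_map]
    refine h.map_of_ker_le ?_
    rw [QuotientGroup.ker_mk', ← MonoidHom.comap_ker, QuotientGroup.ker_mk']
    exact Subgroup.le_comap_map _ _

end Frattini

/-! ### The norm -/

theorem comap_sup_map_of_normal {G H : Type*} [Group G] [Group H] (f : G →* H) (A : Subgroup G)
    (N : Subgroup H) [N.Normal] : (A.map f ⊔ N).comap f = A ⊔ N.comap f := by
  have h := Subgroup.comap_map_eq ((QuotientGroup.mk' N).comp f) A
  rwa [← MonoidHom.comap_ker, QuotientGroup.ker_mk', ← Subgroup.comap_comap, ← Subgroup.map_map,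
    Subgroup.comap_map_eq, QuotientGroup.ker_mk'] at h

namespace GroupClass

section Norm

variable {𝔉 : GroupClass.{u}} {π : Set Nat.Primes} {G H : Type u} [Group G] [Group H]

theorem mem_piGroups_of_card_dvd [Finite H] (h : (piGroups π).Mem G)
    (hd : Nat.card H ∣ Nat.card G) : (piGroups π).Mem H :=
  ⟨inferInstance, fun p hp => h.2 p (hp.trans hd)⟩

theorem mem_piGroups_sup [Finite G] {M N : Subgroup G} [N.Normal] (hM : (piGroups π).Mem M)
    (hN : (piGroups π).Mem N) : (piGroups π).Mem (M ⊔ N : Subgroup G) := by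
  refine ⟨inferInstance, fun p hp => ?_⟩
  rw [← Subgroup.relIndex_bot_left, ← Subgroup.relIndex_mul_relIndex _ _ _ bot_le
    (le_sup_right : N ≤ M ⊔ N), Subgroup.relIndex_sup_right, Subgroup.relIndex_bot_left] at hp
  rcases (Nat.Prime.dvd_mul p.2).1 hp with h | h
  · exact hN.2 p h
  · exact hM.2 p (h.trans (Subgroup.relIndex_dvd_card _ _))

theorem le_piRadical {N : Subgroup G} [hN : N.Normal] (h : (piGroups π).Mem N) :
    N ≤ piRadical π G :=
  le_sSup ⟨hN, h⟩

instance piRadical_normal : (piRadical π G).Normal := by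
  rw [← Subgroup.normalizer_eq_top_iff, Subgroup.eq_top_iff']
  exact fun g => Subgroup.mem_normalizer_iff_map_conj_eq.2 (piRadical_map_conj π g)

theorem mem_piGroups_piRadical [Finite G] : (piGroups π).Mem (piRadical π G) := by
  have hbot : (piGroups π).Mem (⊥ : Subgroup G) := ⟨inferInstance, fun p hp => by
    rw [Subgroup.card_bot] at hp
    exact absurd (Nat.dvd_one.1 hp) p.2.ne_one⟩
  obtain ⟨M, ⟨_, hMπ⟩, hmax⟩ :=
    (Set.toFinite {N : Subgroup G | N.Normal ∧ (piGroups π).Mem N}).exists_maximal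
      ⟨⊥, inferInstance, hbot⟩
  suffices piRadical π G = M by rwa [this]
  refine le_antisymm (sSup_le ?_) (le_piRadical hMπ)
  rintro N ⟨_, hNπ⟩
  exact le_sup_left.trans (hmax ⟨inferInstance, mem_piGroups_sup hNπ hMπ⟩ le_sup_right)

theorem map_piRadical_le [Finite G] (f : G →* H) (hf : Function.Surjective f) :
    (piRadical π G).map f ≤ piRadical π H :=
  have : Finite H := Finite.of_surjective f hf
  have : ((piRadical π G).map f).Normal := Subgroup.Normal.map inferInstance f hf
  le_piRadical (mem_piGroups_of_card_dvd mem_piGroups_piRadical (Subgroup.card_map_dvd _ f))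

theorem comap_piRadical_le [Finite H] (f : G →* H) (hf : Function.Injective f) :
    (piRadical π H).comap f ≤ piRadical π G :=
  have : Finite G := Finite.of_injective f hf
  le_piRadical (mem_piGroups_of_card_dvd mem_piGroups_piRadical
    (Subgroup.card_comap_dvd_of_injective _ f hf))

theorem mem_piNorm_iff {x : G} : x ∈ piNorm 𝔉 π G ↔ ∀ U : Subgroup G,
    x ∈ Subgroup.normalizer (𝔉.subgroupResidual U ⊔ piRadical π G : Subgroup G) :=
  Subgroup.mem_iInf

theorem piRadical_le_piNorm : piRadical π G ≤ piNorm 𝔉 π G :=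
  le_iInf fun _ => le_sup_right.trans Subgroup.le_normalizer

theorem IsFormation.map_piNorm_le (h𝔉 : 𝔉.IsFormation) [Finite G] (f : G →* H)
    (hf : Function.Surjective f) : (piNorm 𝔉 π G).map f ≤ piNorm 𝔉 π H := by
  rintro _ ⟨x, hx, rfl⟩
  refine mem_piNorm_iff.2 fun U => ?_
  have hfx := Subgroup.normalizer_le_normalizer_sup_normal (K := piRadical π H)
    (Subgroup.le_normalizer_map f (Subgroup.mem_map_of_mem f (mem_piNorm_iff.1 hx (U.comap f))))
  rwa [Subgroup.map_sup, ← h𝔉.subgroupResidual_map, Subgroup.map_comap_eq_self_of_surjective hf,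
    sup_assoc, sup_eq_right.2 (map_piRadical_le f hf)] at hfx

theorem IsFormation.comap_piNorm_le (h𝔉 : 𝔉.IsFormation) [Finite H] (f : G →* H)
    (hf : Function.Injective f) : (piNorm 𝔉 π H).comap f ≤ piNorm 𝔉 π G := by
  intro x hx
  have : Finite G := Finite.of_injective f hf
  refine mem_piNorm_iff.2 fun U => ?_
  have hfx := Subgroup.normalizer_le_normalizer_sup_normal (K := piRadical π G)
    (Subgroup.le_normalizer_comap f (Subgroup.mem_comap.2 (mem_piNorm_iff.1 hx (U.map f))))
  rwa [h𝔉.subgroupResidual_map, comap_sup_map_of_normal, sup_assoc,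
    sup_eq_right.2 (comap_piRadical_le f hf)] at hfx

theorem IsFormation.le_piNorm_of_commutator_residual_eq_bot (h𝔉 : 𝔉.IsFormation)
    (hS : 𝔉.IsSubgroupClosed) [Finite G] {L : Subgroup G} (h : ⁅𝔉.residual G, L⁆ = ⊥) :
    L ≤ piNorm 𝔉 π G := by
  refine le_iInf fun U => ?_
  have hU : ⁅𝔉.subgroupResidual U, L⁆ = ⊥ :=
    le_bot_iff.1 ((Subgroup.commutator_mono (h𝔉.subgroupResidual_le_residual hS U) le_rfl).trans
      h.le)
  have hL : L ≤ Subgroup.normalizer (𝔉.subgroupResidual U : Set G) := by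
    rw [Subgroup.le_normalizer_iff_commutator_le_left, hU]
    exact bot_le
  exact hL.trans Subgroup.normalizer_le_normalizer_sup_normal

theorem commutator_subgroupResidual_eq_bot (h : piRadical π G = ⊥) {L M : Subgroup G} [L.Normal]
    (hL : L ≤ piNorm 𝔉 π G) (hML : Disjoint M L) : ⁅𝔉.subgroupResidual M, L⁆ = ⊥ := by
  have hLM : L ≤ Subgroup.normalizer (𝔉.subgroupResidual M : Set G) := fun x hx => by
    simpa only [h, sup_bot_eq] using mem_piNorm_iff.1 (hL hx) M
  refine le_bot_iff.1 (hML.le_bot.trans' (le_inf ?_ (Subgroup.commutator_le_right _ _)))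
  exact (Subgroup.le_normalizer_iff_commutator_le_left.1 hLM).trans (subgroupResidual_le M)

end Norm

end GroupClass

/-! ### Semidirect products with faithful irreducible modules -/

section Irreducible

open SemidirectProduct

variable {G V : Type*} [Group G] [Group V] {ψ : G →* MulAut V}

/-- The action `ψ` of `G` on the nontrivial group `V` leaves no proper nontrivial subgroup
invariant. -/
structure IsIrreducibleAction (ψ : G →* MulAut V) : Prop where
  nontrivial : Nontrivial V
  eq_bot_or_eq_top : ∀ W : Subgroup V, (∀ g, ∀ w ∈ W, ψ g w ∈ W) → W = ⊥ ∨ W = ⊤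

instance finite_semidirectProduct [Finite V] [Finite G] : Finite (V ⋊[ψ] G) :=
  Finite.of_equiv _ equivProd.symm

instance range_inl_normal : (inl : V →* V ⋊[ψ] G).range.Normal := by
  rw [range_inl_eq_ker_rightHom]
  infer_instance

theorem disjoint_range_inr_range_inl :
    Disjoint (inr : G →* V ⋊[ψ] G).range (inl : V →* V ⋊[ψ] G).range := by
  rw [Subgroup.disjoint_def, range_inl_eq_ker_rightHom]
  rintro _ ⟨g, rfl⟩ hg
  rw [show g = 1 from hg, map_one]

theorem centralizer_range_inl [IsMulCommutative V] (hinj : Function.Injective ψ) :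
    Subgroup.centralizer (inl : V →* V ⋊[ψ] G).range = (inl : V →* V ⋊[ψ] G).range := by
  refine le_antisymm (fun x hx => ?_) ?_
  · rw [range_inl_eq_ker_rightHom, MonoidHom.mem_ker, rightHom_eq_right]
    refine (injective_iff_map_eq_one ψ).1 hinj _ (MulEquiv.ext fun v => ?_)
    have hleft := congrArg left (Subgroup.mem_centralizer_iff.1 hx _ ⟨v, rfl⟩)
    simp only [mul_left, left_inl, right_inl, map_one, MulAut.one_apply] at hleft
    rw [mul_comm' v] at hleft
    exact (mul_left_cancel hleft).symm
  · rw [Subgroup.le_centralizer_iff_isMulCommutative]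
    infer_instance

namespace IsIrreducibleAction

variable {N : Subgroup (V ⋊[ψ] G)} [N.Normal]

theorem isMinimalNormal_range_inl (hψ : IsIrreducibleAction ψ) :
    IsMinimalNormal (inl : V →* V ⋊[ψ] G).range := by
  have := hψ.nontrivial
  refine ⟨⟨inferInstance, fun h => ?_⟩, ?_⟩
  · obtain ⟨v, hv⟩ := exists_ne (1 : V)
    rw [MonoidHom.range_eq_bot_iff] at h
    exact hv (inl_injective ((DFunLike.congr_fun h v).trans (map_one inl).symm))
  · rintro N ⟨hN, hN1⟩ hle
    have hinv : ∀ g, ∀ w ∈ N.comap inl, ψ g w ∈ N.comap inl := fun g w hw => by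
      rw [Subgroup.mem_comap, inl_aut, map_inv]
      exact hN.conj_mem _ hw _
    rcases hψ.eq_bot_or_eq_top (N.comap inl) hinv with h | h
    · refine absurd ?_ hN1
      rw [← inf_eq_right.2 hle, ← Subgroup.map_comap_eq, h, Subgroup.map_bot]
    · rintro _ ⟨v, rfl⟩
      exact (Subgroup.eq_top_iff' _).1 h v

theorem range_inl_le [IsMulCommutative V] (hψ : IsIrreducibleAction ψ)
    (hinj : Function.Injective ψ) (hN : N ≠ ⊥) : (inl : V →* V ⋊[ψ] G).range ≤ N := by
  refine hψ.isMinimalNormal_range_inl.inf_eq_bot_or_le.resolve_left fun h => hN ?_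
  have hcomm : ⁅N, (inl : V →* V ⋊[ψ] G).range⁆ = ⊥ :=
    le_bot_iff.1 ((Subgroup.commutator_le_inf _ _).trans h.le)
  rwa [Subgroup.commutator_eq_bot_iff_le_centralizer, centralizer_range_inl hinj,
    ← inf_eq_left, h, eq_comm] at hcomm

theorem isNilpotent_iff_le_range_inl [IsMulCommutative V] (hψ : IsIrreducibleAction ψ)
    (hinj : Function.Injective ψ) : Group.IsNilpotent N ↔ N ≤ (inl : V →* V ⋊[ψ] G).range := by
  constructor
  · intro _
    rw [← centralizer_range_inl hinj, Subgroup.le_centralizer_iff,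
      ← Subgroup.commutator_eq_bot_iff_le_centralizer]
    exact hψ.isMinimalNormal_range_inl.commutator_eq_bot_of_isNilpotent
  · intro hle
    have : IsMulCommutative N := by
      rw [← Subgroup.le_centralizer_iff_isMulCommutative]
      exact hle.trans ((centralizer_range_inl hinj).ge.trans (Subgroup.centralizer_le hle))
    let _ : CommGroup N := { mul_comm := mul_comm' }
    infer_instance

end IsIrreducibleAction

end Irreducible

/-! ### Central chief factors -/

namespace GroupClass

section Central

variable {𝔉 : GroupClass.{u}} {G : Type u} [Group G] {K L R : Subgroup G} [K.Normal]

theorem card_factor : Nat.card (factor K L) = K.relIndex L := by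
  rw [← Subgroup.relIndex_ker, QuotientGroup.ker_mk']

theorem le_ker_factorAction_iff [L.Normal] : R ≤ (factorAction K L).ker ↔ ⁅R, L⁆ ≤ K := by
  have hcomm : ⁅R, L⁆ ≤ K ↔
      R ≤ (Subgroup.centralizer (factor K L)).comap (QuotientGroup.mk' K) := by
    rw [← Subgroup.map_le_iff_le_comap, ← Subgroup.commutator_eq_bot_iff_le_centralizer,
      ← Subgroup.map_commutator, Subgroup.map_eq_bot_iff, QuotientGroup.ker_mk']
  rw [hcomm]
  refine forall₂_congr fun g _ => ?_
  rw [MonoidHom.mem_ker, Subgroup.mem_comap, Subgroup.mem_centralizer_iff, MulEquiv.ext_iff,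
    Subtype.forall]
  refine forall₂_congr fun l _ => ?_
  rw [Subtype.ext_iff]
  change (g : G ⧸ K) * l * (g : G ⧸ K)⁻¹ = l ↔ l * (g : G ⧸ K) = g * l
  rw [mul_inv_eq_iff_eq_mul, eq_comm]

theorem IsChiefFactor.isMinimalNormal (h : IsChiefFactor K L) : IsMinimalNormal (factor K L) := by
  have := h.normal_right
  refine ⟨⟨inferInstance, fun hb => ?_⟩, ?_⟩
  · rw [Subgroup.map_eq_bot_iff, QuotientGroup.ker_mk'] at hb
    exact h.lt.not_ge hb
  · rintro N ⟨_, hN1⟩ hle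
    have hN := Subgroup.map_comap_eq_self_of_surjective (QuotientGroup.mk'_surjective K) N
    have hKN : K ≤ N.comap (QuotientGroup.mk' K) := QuotientGroup.le_comap_mk' K N
    have hNL : N.comap (QuotientGroup.mk' K) ≤ L := by
      refine (Subgroup.comap_mono hle).trans ?_
      rw [Subgroup.comap_map_eq, QuotientGroup.ker_mk', sup_eq_left.2 h.lt.le]
    rcases h.eq_or_eq _ inferInstance hKN hNL with he | he
    · refine absurd ?_ hN1
      rw [← hN, he, QuotientGroup.map_mk'_self]
    · rw [factor, ← he, hN]

theorem IsChiefFactor.isIrreducibleAction [L.Normal] (h : IsChiefFactor K L) :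
    IsIrreducibleAction (QuotientGroup.kerLift (factorAction K L)) where
  nontrivial := (Subgroup.nontrivial_iff_ne_bot _).2 h.isMinimalNormal.ne_bot
  eq_bot_or_eq_top W hW := by
    have : (W.map (factor K L).subtype).Normal := by
      refine ⟨?_⟩
      rintro _ ⟨w, hw, rfl⟩ g
      obtain ⟨g, rfl⟩ := QuotientGroup.mk_surjective g
      exact ⟨factorAction K L g w, hW (g : G ⧸ (factorAction K L).ker) w hw, rfl⟩
    refine (h.isMinimalNormal.eq_bot_or_eq (Subgroup.map_subtype_le W)).imp (fun he => ?_)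
      fun he => ?_
    · exact (Subgroup.map_eq_bot_iff_of_injective _ (Subgroup.subtype_injective _)).1 he
    · rw [← Subgroup.map_subtype_inj, he, ← MonoidHom.range_eq_map, Subgroup.range_subtype]

/-- A chief factor `L / K` of a solvable group is an abelian group on which `G` acts irreducibly,
so the nilpotent normal subgroups of `(L / K) ⋊ (G / C_G(L / K))` lie in `L / K`. -/
theorem IsFormation.isCentralFactor_iff (h𝔉 : 𝔉.IsFormation) [Finite G] [Group.IsSolvable G]
    [L.Normal] (h : IsChiefFactor K L) :
    (formationProduct nilpotent 𝔉).IsCentralFactor K L ↔ ⁅𝔉.residual G, L⁆ ≤ K := by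
  have := h.isMinimalNormal.isMulCommutative
  let ψ := QuotientGroup.kerLift (factorAction K L)
  let T := factor K L ⋊[ψ] (G ⧸ (factorAction K L).ker)
  calc (formationProduct nilpotent 𝔉).Mem T
      ↔ Group.IsNilpotent (𝔉.residual T) :=
        (and_iff_right (inferInstance : Finite T)).trans
          (and_iff_right (inferInstance : Finite (𝔉.residual T)))
    _ ↔ 𝔉.residual T ≤ (SemidirectProduct.rightHom (φ := ψ)).ker := by
        rw [h.isIrreducibleAction.isNilpotent_iff_le_range_inl (QuotientGroup.kerLift_injective _),
          SemidirectProduct.range_inl_eq_ker_rightHom]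
    _ ↔ 𝔉.Mem (G ⧸ (factorAction K L).ker) := by
        rw [← Subgroup.map_eq_bot_iff, h𝔉.map_residual _ SemidirectProduct.rightHom_surjective,
          h𝔉.mem_iff_residual_eq_bot]
    _ ↔ ⁅𝔉.residual G, L⁆ ≤ K := by rw [h𝔉.mem_quotient_iff, le_ker_factorAction_iff]

theorem exists_isChiefFactor [Finite G] {N : Subgroup G} [hN : N.Normal] (h : K < N) :
    ∃ L ≤ N, IsChiefFactor K L := by
  obtain ⟨L, hLN, hL⟩ := (Set.toFinite {L : Subgroup G | L.Normal ∧ K < L}).exists_le_minimal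
    ⟨hN, h⟩
  refine ⟨L, hLN, ‹_›, hL.prop.1, hL.prop.2, fun M hM hKM hML => ?_⟩
  exact hKM.eq_or_lt.imp Eq.symm fun hlt => hL.eq_of_le ⟨hM, hlt⟩ hML

end Central

end GroupClass

/-! ### The norm series and the hypercentre -/

namespace GroupClass

section Series

variable {𝔉 : GroupClass.{u}} {π : Set Nat.Primes} {G : Type u} [Group G]

instance piNormSeries_normal (i : ℕ) : (piNormSeries 𝔉 π G i).1.Normal :=
  (piNormSeries 𝔉 π G i).2

theorem piNormSeries_monotone : Monotone fun i => (piNormSeries 𝔉 π G i).1 :=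
  monotone_nat_of_le_succ fun _ => QuotientGroup.le_comap_mk' _ _

theorem piNormSeries_le_piNormInfty (i : ℕ) : (piNormSeries 𝔉 π G i).1 ≤ piNormInfty 𝔉 π G :=
  le_iSup (fun i => (piNormSeries 𝔉 π G i).1) i

theorem exists_piNormSeries_eq_piNormInfty [Finite G] :
    ∃ n, (piNormSeries 𝔉 π G n).1 = piNormInfty 𝔉 π G :=
  ⟨_, (WellFoundedGT.iSup_eq_monotonicSequenceLimit
    (⟨fun i => (piNormSeries 𝔉 π G i).1, piNormSeries_monotone⟩ : ℕ →o Subgroup G)).symm⟩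

/-- If `N ≰ D`, choose a chief factor `L / (D ⊓ N)` below `N`. It is isomorphic to the image of `L`
in `G ⧸ D`, which either centralises the residual or is a `π'`-group, so lies in the norm. -/
theorem IsFormation.le_of_isPiHypercentral (h𝔉 : 𝔉.IsFormation) (hS : 𝔉.IsSubgroupClosed)
    [Finite G] [Group.IsSolvable G] {N D : Subgroup G} [D.Normal]
    (hN : IsPiHypercentral (formationProduct nilpotent 𝔉) π N)
    (hD : (piNorm 𝔉 πᶜ (G ⧸ D)).comap (QuotientGroup.mk' D) ≤ D) : N ≤ D := by
  have := hN.normal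
  by_contra hND
  obtain ⟨L, hLN, hL⟩ := exists_isChiefFactor (K := D ⊓ N) (N := N) (inf_lt_right.2 hND)
  have := hL.normal_right
  have hDL : D ⊓ L = D ⊓ N := le_antisymm (inf_le_inf_left D hLN) (le_inf inf_le_left hL.lt.le)
  have : (L.map (QuotientGroup.mk' D)).Normal :=
    Subgroup.Normal.map ‹_› _ (QuotientGroup.mk'_surjective D)
  have hcard : Nat.card (L.map (QuotientGroup.mk' D)) = Nat.card (factor (D ⊓ N) L) := by
    rw [card_factor, ← Subgroup.relIndex_ker, QuotientGroup.ker_mk',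
      ← Subgroup.inf_relIndex_right D L, hDL]
  suffices hnorm : L.map (QuotientGroup.mk' D) ≤ piNorm 𝔉 πᶜ (G ⧸ D) from
    hL.lt.not_ge (le_inf ((Subgroup.map_le_iff_le_comap.1 hnorm).trans hD) hLN)
  by_cases hπ : ∃ p ∈ π, (p : ℕ) ∣ Nat.card (factor (D ⊓ N) L)
  · have hcomm : ⁅𝔉.residual G, L⁆ ≤ D :=
      ((h𝔉.isCentralFactor_iff hL).1 (hN.central _ _ hL hLN hπ)).trans inf_le_left
    apply h𝔉.le_piNorm_of_commutator_residual_eq_bot hS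
    rwa [← h𝔉.map_residual _ (QuotientGroup.mk'_surjective D), ← Subgroup.map_commutator,
      Subgroup.map_eq_bot_iff, QuotientGroup.ker_mk']
  · refine (le_piRadical ⟨inferInstance, fun p hp hpπ => hπ ⟨p, hpπ, ?_⟩⟩).trans
      piRadical_le_piNorm
    rwa [← hcard]

theorem IsFormation.piHypercentre_le_piNormInfty (h𝔉 : 𝔉.IsFormation) (hS : 𝔉.IsSubgroupClosed)
    [Finite G] [Group.IsSolvable G] :
    piHypercentre (formationProduct nilpotent 𝔉) π G ≤ piNormInfty 𝔉 πᶜ G := by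
  obtain ⟨n, hn⟩ := exists_piNormSeries_eq_piNormInfty (𝔉 := 𝔉) (π := πᶜ) (G := G)
  rw [← hn]
  exact sSup_le fun N hN => h𝔉.le_of_isPiHypercentral hS hN
    ((piNormSeries_le_piNormInfty (n + 1)).trans hn.ge)

end Series

end GroupClass

/-! ### The norm series and maximal subgroups -/

namespace GroupClass

section NormInMaximal

variable {𝔉 : GroupClass.{u}} {π : Set Nat.Primes} {G Y : Type u} [Group G] [Group Y]

theorem le_intMaximal {𝔛 : GroupClass.{u}} {N : Subgroup G}
    (h : ∀ U : Subgroup G, 𝔛.Mem U → 𝔛.Mem (U ⊔ N : Subgroup G)) : N ≤ intMaximal 𝔛 G := by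
  refine le_sInf fun U hU => ?_
  replace hU : Maximal (fun V : Subgroup G => 𝔛.Mem V) U := hU
  exact le_sup_right.trans (hU.le_of_ge (h U hU.prop) le_sup_left)

theorem subgroup_le_normalizer_subgroupResidual (M : Subgroup G) :
    M ≤ Subgroup.normalizer (𝔉.subgroupResidual M : Set G) := by
  have := Subgroup.le_normalizer_map (H := 𝔉.residual M) M.subtype
  rwa [Subgroup.normalizer_eq_top, ← MonoidHom.range_eq_map, Subgroup.range_subtype] at this

theorem subgroupResidual_normal {L M : Subgroup G} (hML : M ⊔ L = ⊤)
    (h : ⁅𝔉.subgroupResidual M, L⁆ = ⊥) : (𝔉.subgroupResidual M).Normal := by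
  rw [← Subgroup.normalizer_eq_top_iff, eq_top_iff, ← hML, sup_le_iff,
    Subgroup.le_normalizer_iff_commutator_le_left (H := L), h]
  exact ⟨subgroup_le_normalizer_subgroupResidual M, bot_le⟩

namespace IsFormation

variable {p : Nat.Primes}

/-- The residual of the complement `M` is centralised by `L`, so it is normal in `G`, and `G` embeds
into `G ⧸ M^𝔉 × G ⧸ L`. -/
theorem isPNilpotent_residual_of_isCompl (h𝔉 : 𝔉.IsFormation) [Finite G]
    (hcore : piRadical π G = ⊥) {L M : Subgroup G} [L.Normal] (hML : IsCompl M L)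
    (hLp : IsPGroup (p : ℕ) L) (hL1 : L ≠ ⊥) (hL : L ≤ piNorm 𝔉 π G)
    (hquot : ∀ (K : Subgroup G) [K.Normal], K ≠ ⊥ →
      IsPNilpotent (p : ℕ) ((𝔉.residual G).map (QuotientGroup.mk' K))) :
    IsPNilpotent (p : ℕ) (𝔉.residual G) := by
  have hML_top : M ⊔ (QuotientGroup.mk' L).ker = ⊤ := by
    rw [QuotientGroup.ker_mk', hML.sup_eq_top]
  have := subgroupResidual_normal hML.sup_eq_top
    (commutator_subgroupResidual_eq_bot hcore hL hML.disjoint)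
  by_cases hM : 𝔉.subgroupResidual M = ⊥
  · have hle : 𝔉.residual G ≤ L := by
      rw [← QuotientGroup.ker_mk' L, ← Subgroup.map_eq_bot_iff,
        ← h𝔉.map_subgroupResidual_eq_of_sup_ker_eq_top hML_top, hM, Subgroup.map_bot]
    exact .of_isPGroup (hLp.to_le hle)
  · refine (hquot _ hM).of_map_of_map (hquot L hL1) ?_
    rw [QuotientGroup.ker_mk', QuotientGroup.ker_mk']
    exact (hML.disjoint.mono_left (subgroupResidual_le M)).eq_bot

theorem isPNilpotent_residual_of_isMinimalNormal (h𝔉 : 𝔉.IsFormation) (hp : p ∉ π) [Finite G]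
    [Group.IsSolvable G] {L : Subgroup G} (hL : IsMinimalNormal L) (hLN : L ≤ piNorm 𝔉 π G)
    (hquot : ∀ (K : Subgroup G) [K.Normal], K ≠ ⊥ →
      IsPNilpotent (p : ℕ) ((𝔉.residual G).map (QuotientGroup.mk' K))) :
    IsPNilpotent (p : ℕ) (𝔉.residual G) := by
  have : Fact (p : ℕ).Prime := ⟨p.2⟩
  have := hL.normal
  have of_coprime (K : Subgroup G) [K.Normal] (hK : K ≠ ⊥) (hKp : (Nat.card K).Coprime p) :
      IsPNilpotent (p : ℕ) (𝔉.residual G) :=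
    (hquot K hK).of_map_of_coprime_ker (by rwa [QuotientGroup.ker_mk'])
  by_cases hcore : piRadical π G = ⊥
  swap
  · exact of_coprime _ hcore (coprime_card_of_mem_piGroups mem_piGroups_piRadical hp)
  by_cases hΦ : L ≤ frattini G
  · exact isPNilpotent_of_le_frattini hΦ (hquot L hL.ne_bot)
  obtain ⟨q, hq, hLq⟩ := hL.exists_isPGroup
  by_cases hqp : q = p
  swap
  · exact of_coprime L hL.ne_bot (coprime_card_of_isPGroup_of_ne p.2 hq hLq hqp)
  obtain ⟨M, hML⟩ := hL.exists_isCompl hΦ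
  exact h𝔉.isPNilpotent_residual_of_isCompl hcore hML (hqp ▸ hLq) hL.ne_bot hLN hquot

theorem isPNilpotent_residual_of_ker_le_piNorm (h𝔉 : 𝔉.IsFormation) (hp : p ∉ π) [Finite G]
    [Group.IsSolvable G] {f : G →* Y} (hf : f.ker ≤ piNorm 𝔉 π G)
    (h : IsPNilpotent (p : ℕ) ((𝔉.residual G).map f)) : IsPNilpotent (p : ℕ) (𝔉.residual G) := by
  have : Fact (p : ℕ).Prime := ⟨p.2⟩
  induction hn : Nat.card G using Nat.strong_induction_on generalizing G Y with
  | _ n ih =>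
  subst hn
  by_cases hker : f.ker = ⊥
  · exact h.of_map_of_injective (f.ker_eq_bot_iff.1 hker)
  obtain ⟨L, hLf, hL⟩ := exists_isMinimalNormal_le hker
  refine h𝔉.isPNilpotent_residual_of_isMinimalNormal hp hL (hLf.trans hf) fun K _ hK => ?_
  have hKsurj := QuotientGroup.mk'_surjective K
  have : (f.ker.map (QuotientGroup.mk' K)).Normal := Subgroup.Normal.map inferInstance _ hKsurj
  rw [h𝔉.map_residual _ hKsurj]
  refine ih _ (card_quotient_lt hK) (f := QuotientGroup.mk' (f.ker.map (QuotientGroup.mk' K)))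
    ?_ ?_ rfl
  · rw [QuotientGroup.ker_mk']
    exact (Subgroup.map_mono hf).trans (h𝔉.map_piNorm_le _ hKsurj)
  · rw [← h𝔉.map_residual _ hKsurj, Subgroup.map_map]
    refine h.map_of_ker_le ?_
    rw [← MonoidHom.comap_ker, QuotientGroup.ker_mk']
    exact Subgroup.le_comap_map _ _

theorem isPNilpotent_subgroupResidual_of_ker_le_piNorm (h𝔉 : 𝔉.IsFormation) (hp : p ∉ π) [Finite G]
    [Group.IsSolvable G] {f : G →* Y} (hf : f.ker ≤ piNorm 𝔉 π G) {W : Subgroup G}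
    (h : IsPNilpotent (p : ℕ) ((𝔉.subgroupResidual W).map f)) :
    IsPNilpotent (p : ℕ) (𝔉.subgroupResidual W) := by
  have : Fact (p : ℕ).Prime := ⟨p.2⟩
  rw [subgroupResidual, Subgroup.map_map] at h
  refine (h𝔉.isPNilpotent_residual_of_ker_le_piNorm hp ?_ h).map W.subtype
  rw [← MonoidHom.comap_ker]
  exact (Subgroup.comap_mono hf).trans (h𝔉.comap_piNorm_le _ W.subtype_injective)

theorem isPNilpotent_subgroupResidual_of_map_piNormSeries (h𝔉 : 𝔉.IsFormation) (hp : p ∉ π)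
    [Finite G] [Group.IsSolvable G] {W : Subgroup G} {n : ℕ} (h : IsPNilpotent (p : ℕ)
      ((𝔉.subgroupResidual W).map (QuotientGroup.mk' (piNormSeries 𝔉 π G n).1))) :
    IsPNilpotent (p : ℕ) (𝔉.subgroupResidual W) := by
  have : Fact (p : ℕ).Prime := ⟨p.2⟩
  induction n with
  | zero =>
    exact h.of_map_of_injective ((MonoidHom.ker_eq_bot_iff _).1 (QuotientGroup.ker_mk' _))
  | succ n ih =>
    apply ih
    let D := (piNormSeries 𝔉 π G n).1
    rw [← h𝔉.subgroupResidual_map]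
    refine h𝔉.isPNilpotent_subgroupResidual_of_ker_le_piNorm hp
      (f := QuotientGroup.mk' (piNorm 𝔉 π (G ⧸ D))) (QuotientGroup.ker_mk' _).le ?_
    rw [h𝔉.subgroupResidual_map, Subgroup.map_map]
    refine h.map_of_ker_le ?_
    rw [QuotientGroup.ker_mk', ← MonoidHom.comap_ker, QuotientGroup.ker_mk']
    rfl

theorem piNormInfty_le_intMaximal (h𝔉 : 𝔉.IsFormation) [Finite G] [Group.IsSolvable G] :
    piNormInfty 𝔉 πᶜ G ≤ intMaximal (formationProduct (piNilpotent π) 𝔉) G := by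
  obtain ⟨n, hn⟩ := exists_piNormSeries_eq_piNormInfty (𝔉 := 𝔉) (π := πᶜ) (G := G)
  rw [← hn]
  refine le_intMaximal fun U hU => ?_
  have hUmem := mem_piNilpotent_product_subgroup_iff.1 hU
  refine mem_piNilpotent_product_subgroup_iff.2 fun p hp => ?_
  have : Fact (p : ℕ).Prime := ⟨p.2⟩
  have hp' : p ∉ πᶜ := Set.notMem_compl_iff.2 hp
  refine h𝔉.isPNilpotent_subgroupResidual_of_map_piNormSeries hp' (n := n) ?_
  rw [← h𝔉.subgroupResidual_map, Subgroup.map_sup, QuotientGroup.map_mk'_self, sup_bot_eq,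
    h𝔉.subgroupResidual_map]
  exact (hUmem p hp).map _

end IsFormation

end NormInMaximal

end GroupClass

/-! ### Hypercentrality of the intersection of maximal subgroups -/

namespace GroupClass

section IntersectionHypercentral

open scoped commutatorElement

theorem mem_map_conj_iff {𝔛 : GroupClass.{u}} {G : Type u} [Group G] (g : G) {U : Subgroup G} :
    𝔛.Mem (U.map (MulAut.conj g).toMonoidHom) ↔ 𝔛.Mem U :=
  ⟨𝔛.mem_of_mulEquiv _ _ ((MulAut.conj g).subgroupMap U).symm,
    𝔛.mem_of_mulEquiv _ _ ((MulAut.conj g).subgroupMap U)⟩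

theorem intMaximal_normal {𝔛 : GroupClass.{u}} {G : Type u} [Group G] :
    (intMaximal 𝔛 G).Normal := by
  refine ⟨fun x hx g => Subgroup.mem_sInf.2 fun U hU => ?_⟩
  replace hU : Maximal (fun V : Subgroup G => 𝔛.Mem V) U := hU
  let e : Subgroup G ≃o Subgroup G := (MulAut.conj g).mapSubgroup
  have hmax : Maximal (fun V : Subgroup G => 𝔛.Mem V) (e.symm U) := by
    refine ⟨(mem_map_conj_iff g).1 ?_, fun V hV hle => e.le_symm_apply.2 ?_⟩
    · change 𝔛.Mem (e (e.symm U))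
      rw [e.apply_symm_apply]
      exact hU.prop
    · exact hU.le_of_ge ((mem_map_conj_iff g).2 hV) (e.symm_apply_le.1 hle)
  obtain ⟨u, hu, rfl⟩ := Subgroup.mem_sInf.1 hx _ hmax
  simpa [mul_assoc] using hu

variable {𝔉 : GroupClass.{u}} {π : Set Nat.Primes} {G Y : Type u} [Group G] [Group Y]

namespace IsFormation

variable {p : Nat.Primes} {f : G →* Y}

theorem isSCritical_of_surjective (h𝔉 : 𝔉.IsFormation) [Finite G] (hf : Function.Surjective f)
    (hG : ¬ IsPGroup p ((𝔉.residual G).map f))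
    (hM : ∀ M : Subgroup G, M < ⊤ → IsPGroup p ((𝔉.subgroupResidual M).map f)) :
    IsSCritical (formationProduct (piGroups {p}) 𝔉) Y := by
  have := Finite.of_surjective f hf
  refine ⟨inferInstance, ?_, fun B hB => ?_⟩
  · rwa [mem_piGroups_singleton_product_iff, ← h𝔉.map_residual f hf]
  · rw [mem_piGroups_singleton_product_subgroup_iff,
      ← Subgroup.map_comap_eq_self_of_surjective hf B, h𝔉.subgroupResidual_map]
    refine hM _ (lt_top_iff_ne_top.2 fun h => hB.ne ?_)
    rw [← Subgroup.map_comap_eq_self_of_surjective hf B, h, Subgroup.map_top_of_surjective f hf]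

theorem ker_le_frattini (h𝔉 : 𝔉.IsFormation) [Finite G]
    (hG : ¬ IsPGroup p ((𝔉.residual G).map f))
    (hM : ∀ M : Subgroup G, M < ⊤ → IsPGroup p ((𝔉.subgroupResidual M).map f)) :
    f.ker ≤ frattini G := by
  refine le_iInf₂ fun M hMmax => ?_
  by_contra hker
  have := hM M hMmax.lt_top
  rw [h𝔉.map_subgroupResidual_eq_of_sup_ker_eq_top (hMmax.2 _ (left_lt_sup.2 hker))] at this
  exact hG this

theorem mem_piNilpotent_product_of_critical (h𝔉 : 𝔉.IsFormation)
    (hcrit : BoundaryConditionIIISolvable 𝔉 π) (hp : p ∈ π) [Finite G] [Group.IsSolvable G]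
    (hf : Function.Surjective f) (hG : ¬ IsPGroup p ((𝔉.residual G).map f))
    (hM : ∀ M : Subgroup G, M < ⊤ → IsPGroup p ((𝔉.subgroupResidual M).map f)) :
    (formationProduct (piNilpotent π) 𝔉).Mem G := by
  have := Finite.of_surjective f hf
  have hY := mem_piNilpotent_product_iff.1 <| hcrit p hp Y (h𝔉.isSCritical_of_surjective hf hG hM)
    ⟨inferInstance, Group.isSolvable_of_surjective hf⟩
  refine mem_piNilpotent_product_iff.2 fun r hr => ?_
  have : Fact (r : ℕ).Prime := ⟨r.2⟩
  refine isPNilpotent_of_le_frattini (h𝔉.ker_le_frattini hG hM) ?_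
  have := hY r hr
  rw [← h𝔉.map_residual f hf] at this
  exact this.map_of_ker_le (QuotientGroup.ker_mk' _).ge

/-- A subgroup `H` minimal with this property works: its image under `f` is critical, and the kernel
of `f` on `H` lies in the Frattini subgroup of `H`. -/
theorem exists_mem_piNilpotent_product_not_isPGroup (h𝔉 : 𝔉.IsFormation)
    (hcrit : BoundaryConditionIIISolvable 𝔉 π) (hp : p ∈ π) [Finite G] [Group.IsSolvable G]
    (hG : ¬ IsPGroup p ((𝔉.residual G).map f)) :
    ∃ H : Subgroup G, (formationProduct (piNilpotent π) 𝔉).Mem H ∧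
      ¬ IsPGroup p ((𝔉.subgroupResidual H).map f) := by
  obtain ⟨H, hH⟩ := (Set.toFinite
    {H : Subgroup G | ¬ IsPGroup p ((𝔉.subgroupResidual H).map f)}).exists_minimal
    ⟨⊤, by rwa [Set.mem_ofPred, h𝔉.subgroupResidual_top]⟩
  have hmap (M : Subgroup H) : (𝔉.subgroupResidual (M.map H.subtype)).map f =
      (𝔉.subgroupResidual M).map (f.comp H.subtype) := by
    rw [h𝔉.subgroupResidual_map, Subgroup.map_map]
  refine ⟨H, h𝔉.mem_piNilpotent_product_of_critical hcrit hp
    (f.comp H.subtype).rangeRestrict_surjective ?_ fun M hM => ?_, hH.prop⟩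
  · rw [isPGroup_map_iff, MonoidHom.ker_rangeRestrict, ← isPGroup_map_iff, ← Subgroup.map_map]
    exact hH.prop
  · rw [isPGroup_map_iff, MonoidHom.ker_rangeRestrict, ← isPGroup_map_iff, ← hmap]
    by_contra hc
    refine hM.not_ge ?_
    rw [← Subgroup.map_subtype_le_map_subtype, ← MonoidHom.range_eq_map, Subgroup.range_subtype]
    exact hH.le_of_le hc (Subgroup.map_subtype_le M)

end IsFormation

variable {p : ℕ} {K L R : Subgroup G} [K.Normal]

theorem isPGroup_map_factorAction_of_isPNilpotent [Finite G] [Fact p.Prime] [L.Normal]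
    (hR : IsPNilpotent p R) (hLR : L ≤ Subgroup.normalizer (R : Set G))
    (hL : IsPGroup p (factor K L)) : IsPGroup p (R.map (factorAction K L)) := by
  have hcomm {y l : G} (hy : y ∈ R) (hyp : (orderOf y).Coprime p) (hl : l ∈ L) : ⁅y, l⁆ ∈ K := by
    have hly : l * y⁻¹ * l⁻¹ ∈ R := (Subgroup.mem_normalizer_iff.1 (hLR hl) _).1 (inv_mem hy)
    have hprod : (orderOf ⁅y, l⁆).Coprime p := by
      rw [commutatorElement_def, mul_assoc, mul_assoc, ← mul_assoc l]
      exact hR y hy _ hly hyp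
        (coprime_orderOf_map (MulAut.conj l).toMonoidHom (by rwa [orderOf_inv]))
    have hmem : QuotientGroup.mk' K ⁅y, l⁆ ∈ factor K L :=
      Subgroup.mem_map_of_mem _ (Subgroup.commutator_le_right ⊤ L
        (Subgroup.commutator_mem_commutator (Subgroup.mem_top y) hl))
    exact (QuotientGroup.eq_one_iff _).1
      (eq_one_of_isPGroup_of_coprime hL hmem (coprime_orderOf_map (QuotientGroup.mk' K) hprod))
  refine isPGroup_map_iff.2 fun x hx => ?_
  obtain ⟨a, ha⟩ := exists_coprime_orderOf_pow (p := p) x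
  refine ⟨a, ?_⟩
  rw [← Subgroup.zpowers_le, le_ker_factorAction_iff, Subgroup.commutator_le]
  rintro _ ⟨n, rfl⟩ l hl
  exact hcomm (R.zpow_mem (R.pow_mem hx _) n)
    (ha.coprime_dvd_left (orderOf_dvd_of_mem_zpowers (Subgroup.zpow_mem_zpowers _ n))) hl

theorem IsChiefFactor.commutator_le_of_isPGroup [Finite G] [Fact p.Prime] [L.Normal] [R.Normal]
    (h : IsChiefFactor K L) (hL : p ∣ Nat.card (factor K L))
    (hR : IsPGroup p (R.map (factorAction K L))) : ⁅R, L⁆ ≤ K := by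
  obtain ⟨b, hb, hb1⟩ := hR.exists_fixed_point_of_prime_dvd_card_of_fixed_point (factor K L) hL
    (a := 1) (fun g => map_one g.1)
  let C := Subgroup.centralizer (R.map (QuotientGroup.mk' K) : Set (G ⧸ K))
  have : (R.map (QuotientGroup.mk' K)).Normal :=
    Subgroup.Normal.map ‹_› _ (QuotientGroup.mk'_surjective K)
  have hbC : (b : G ⧸ K) ∈ C := by
    rintro _ ⟨r, hr, rfl⟩
    exact mul_inv_eq_iff_eq_mul.1
      (congrArg Subtype.val (hb ⟨_, Subgroup.mem_map_of_mem (factorAction K L) hr⟩))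
  have hLC : factor K L ≤ C := by
    refine h.isMinimalNormal.inf_eq_bot_or_le.resolve_left fun hbot => hb1 (Subtype.ext ?_)
    exact (Subgroup.mem_bot.1 (hbot ▸ ⟨hbC, b.2⟩)).symm
  rwa [← Subgroup.commutator_eq_bot_iff_le_centralizer, Subgroup.commutator_comm,
    ← Subgroup.map_commutator, Subgroup.map_eq_bot_iff, QuotientGroup.ker_mk'] at hLC

theorem IsFormation.isPiHypercentral_intMaximal (h𝔉 : 𝔉.IsFormation) (hS : 𝔉.IsSubgroupClosed)
    (hcrit : BoundaryConditionIIISolvable 𝔉 π) [Finite G] [Group.IsSolvable G] :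
    IsPiHypercentral (formationProduct nilpotent 𝔉) π
      (intMaximal (formationProduct (piNilpotent π) 𝔉) G) := by
  refine ⟨intMaximal_normal, ?_⟩
  rintro K L _ hLn hKL hLI ⟨p, hp, hpd⟩
  have : Fact (p : ℕ).Prime := ⟨p.2⟩
  rw [h𝔉.isCentralFactor_iff hKL]
  refine hKL.commutator_le_of_isPGroup hpd ?_
  by_contra hnot
  obtain ⟨H, hHX, hH⟩ := h𝔉.exists_mem_piNilpotent_product_not_isPGroup hcrit hp hnot
  obtain ⟨U, hHU, hU⟩ := (Set.toFinite {V : Subgroup G |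
    (formationProduct (piNilpotent π) 𝔉).Mem V}).exists_le_maximal hHX
  have hUp := mem_piNilpotent_product_subgroup_iff.1 hU.prop p hp
  have hLp : IsPGroup p (factor K L) := by
    obtain ⟨q, hq, hLq⟩ := hKL.isMinimalNormal.exists_isPGroup
    by_cases hqp : q = p
    · exact hqp ▸ hLq
    · have := (coprime_card_of_isPGroup_of_ne p.2 hq hLq hqp).symm
      exact absurd hpd ((Nat.Prime.coprime_iff_not_dvd p.2).1 this)
  have hLU : L ≤ Subgroup.normalizer (𝔉.subgroupResidual U : Set G) :=
    (hLI.trans (sInf_le hU)).trans (subgroup_le_normalizer_subgroupResidual U)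
  exact hH ((isPGroup_map_factorAction_of_isPNilpotent hUp hLU hLp).to_le
    (Subgroup.map_mono (h𝔉.subgroupResidual_mono hS hHU)))

end IntersectionHypercentral

end GroupClass

/-! ### Existence of faithful irreducible modules -/

section FaithfulIrreducible

variable {G M : Type*} [Group G]

/-- The action by automorphisms on an invariant subgroup. -/
def restrictAction [Group M] (ψ : G →* MulAut M) (W : Subgroup M)
    (hW : ∀ g, ∀ w ∈ W, ψ g w ∈ W) : G →* MulAut W where
  toFun g :=
    { toFun := fun w => ⟨ψ g w, hW g w w.2⟩
      invFun := fun w => ⟨ψ g⁻¹ w, hW g⁻¹ w w.2⟩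
      left_inv := fun w => Subtype.ext (by simp)
      right_inv := fun w => Subtype.ext (by simp)
      map_mul' := fun v w => Subtype.ext (by simp) }
  map_one' := by ext; simp
  map_mul' g h := by ext; simp

theorem exists_isIrreducibleAction_restrictAction [Group M] [Finite M] {ψ : G →* MulAut M}
    {A : Subgroup M} (hA : ∀ g, ∀ a ∈ A, ψ g a ∈ A) (hA1 : A ≠ ⊥) :
    ∃ (W : Subgroup M) (hW : ∀ g, ∀ w ∈ W, ψ g w ∈ W), W ≤ A ∧
      IsIrreducibleAction (restrictAction ψ W hW) := by
  obtain ⟨W, hWA, hW⟩ := (Set.toFinite {W : Subgroup M |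
    (∀ g, ∀ w ∈ W, ψ g w ∈ W) ∧ W ≠ ⊥}).exists_le_minimal ⟨hA, hA1⟩
  refine ⟨W, hW.prop.1, hWA, W.nontrivial_iff_ne_bot.2 hW.prop.2, fun B hB => ?_⟩
  refine or_iff_not_imp_left.2 fun hB1 => ?_
  rw [← Subgroup.map_subtype_inj, ← MonoidHom.range_eq_map, Subgroup.range_subtype]
  refine hW.eq_of_le ⟨?_, ?_⟩ (Subgroup.map_subtype_le B)
  · rintro g _ ⟨b, hb, rfl⟩
    exact ⟨_, hB g b hb, rfl⟩
  · rwa [ne_eq, Subgroup.map_eq_bot_iff_of_injective _ W.subtype_injective]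

section Norm

variable [CommGroup M] {L : Subgroup G} [Fintype L] {ψ : G →* MulAut M}

/-- The norm map `m ↦ ∏ l ∈ L, l • m` of the subgroup `L` acting on an abelian group. -/
def actionNorm (ψ : G →* MulAut M) (L : Subgroup G) [Fintype L] : M →* M :=
  ∏ l : L, (ψ l).toMonoidHom

theorem actionNorm_apply (m : M) : actionNorm ψ L m = ∏ l : L, ψ l m := by
  simp only [actionNorm, MonoidHom.finsetProd_apply]
  rfl

theorem actionNorm_smul [L.Normal] (g : G) (m : M) :
    actionNorm ψ L (ψ g m) = ψ g (actionNorm ψ L m) := by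
  simp only [actionNorm_apply, map_prod]
  refine Fintype.prod_equiv (MulAut.conjNormal g⁻¹ : MulAut L).toEquiv _ _ fun l => ?_
  rw [← MulAut.mul_apply, ← MulAut.mul_apply, ← map_mul, ← map_mul]
  congr 2
  simp [mul_assoc]

theorem actionNorm_smul_of_mem {l : G} (hl : l ∈ L) (m : M) :
    actionNorm ψ L (ψ l m) = actionNorm ψ L m := by
  simp only [actionNorm_apply]
  refine Fintype.prod_equiv (Equiv.mulRight ⟨l, hl⟩) _ _ fun k => ?_
  rw [← MulAut.mul_apply, ← map_mul]
  rfl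

theorem actionNorm_of_forall_eq {m : M} (h : ∀ l ∈ L, ψ l m = m) :
    actionNorm ψ L m = m ^ Nat.card L := by
  rw [actionNorm_apply, Fintype.prod_congr _ _ fun l : L => h l l.2, Finset.prod_const,
    Finset.card_univ, Nat.card_eq_fintype_card]

end Norm

variable {p : ℕ} {L : Subgroup G} [L.Normal]

/-- An irreducible subgroup inside the kernel of the norm of `L` works: on the fixed points of `L`
the norm is the `|L|`-th power, hence injective. -/
theorem exists_isIrreducibleAction_not_le_ker [CommGroup M] [Finite M] [Finite L]
    (hM : IsPGroup p M) {ψ : G →* MulAut M} (hL : ¬ L ≤ ψ.ker) (hLp : (Nat.card L).Coprime p) :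
    ∃ (W : Subgroup M) (hW : ∀ g, ∀ w ∈ W, ψ g w ∈ W),
      IsIrreducibleAction (restrictAction ψ W hW) ∧ ¬ L ≤ (restrictAction ψ W hW).ker := by
  have := Fintype.ofFinite L
  have hker : (actionNorm ψ L).ker ≠ ⊥ := by
    obtain ⟨l, hl, hψl⟩ := SetLike.not_le_iff_exists.1 hL
    refine fun hbot => hψl (MulEquiv.ext fun m => ?_)
    rw [MonoidHom.ker_eq_bot_iff] at hbot
    exact hbot (actionNorm_smul_of_mem hl m)
  obtain ⟨W, hW, hWker, hirr⟩ := exists_isIrreducibleAction_restrictAction (ψ := ψ)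
    (A := (actionNorm ψ L).ker)
    (fun g a ha => by rw [MonoidHom.mem_ker, actionNorm_smul, MonoidHom.mem_ker.1 ha, map_one])
    hker
  refine ⟨W, hW, hirr, fun hle => ?_⟩
  refine W.nontrivial_iff_ne_bot.1 hirr.nontrivial ((Subgroup.eq_bot_iff_forall _).2 fun w hw => ?_)
  have hfix (l : G) (hl : l ∈ L) : ψ l w = w :=
    congrArg Subtype.val (DFunLike.congr_fun (MonoidHom.mem_ker.1 (hle hl)) (⟨w, hw⟩ : W))
  refine eq_one_of_isPGroup_of_coprime (hM.to_subgroup W) hw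
    (hLp.coprime_dvd_left (orderOf_dvd_of_pow_eq_one ?_))
  rw [← actionNorm_of_forall_eq hfix, MonoidHom.mem_ker.1 (hWker hw)]

theorem exists_isIrreducibleAction_injective {G : Type u} [Group G] [Finite G] [hp : Fact p.Prime]
    {L : Subgroup G} (hL : L ≠ ⊥) (hLp : (Nat.card L).Coprime p) [L.Normal]
    (hLmin : ∀ (N : Subgroup G) [N.Normal], N ≠ ⊥ → L ≤ N) :
    ∃ (V : Type u) (_ : CommGroup V) (ψ : G →* MulAut V), Finite V ∧ IsPGroup p V ∧
      IsIrreducibleAction ψ ∧ Function.Injective ψ := by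
  classical
  let ρ : G →* MulAut (G → Multiplicative (ZMod p)) := mulAutArrow
  have hM : IsPGroup p (G → Multiplicative (ZMod p)) := fun f => ⟨1, funext fun x => by
    change (p ^ 1 : ℕ) • Multiplicative.toAdd (f x) = 0
    simp⟩
  have hρ : ¬ L ≤ ρ.ker := by
    obtain ⟨l, hl, hl1⟩ := L.bot_or_exists_ne_one.resolve_left hL
    intro hle
    let δ : G → Multiplicative (ZMod p) := Pi.mulSingle 1 (Multiplicative.ofAdd 1)
    have hδ : δ (l⁻¹ * 1) = δ 1 := congrFun (DFunLike.congr_fun (MonoidHom.mem_ker.1 (hle hl)) δ) 1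
    simp only [δ] at hδ
    rw [mul_one, Pi.mulSingle_eq_same, Pi.mulSingle_eq_of_ne (inv_ne_one.2 hl1)] at hδ
    exact zero_ne_one (Multiplicative.ofAdd.injective hδ : (0 : ZMod p) = 1)
  obtain ⟨W, hW, hirr, hLW⟩ := exists_isIrreducibleAction_not_le_ker hM hρ hLp
  refine ⟨W, inferInstance, restrictAction ρ W hW, inferInstance, hM.to_subgroup W, hirr, ?_⟩
  rw [← MonoidHom.ker_eq_bot_iff]
  by_contra hker
  exact hLW (hLmin _ hker)

end FaithfulIrreducible

/-! ### Critical groups outside the product class -/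

namespace IsMinimalNormal

variable {G : Type*} [Group G] [Finite G] [Group.IsSolvable G] {p : ℕ} [Fact p.Prime]
  {L R : Subgroup G} [L.Normal]

theorem isPGroup_of_not_isPNilpotent (hL : IsMinimalNormal L) (hR : ¬ IsPNilpotent p R)
    (h : IsPNilpotent p (R.map (QuotientGroup.mk' L))) : IsPGroup p L := by
  obtain ⟨q, hq, hLq⟩ := hL.exists_isPGroup
  by_cases hqp : q = p
  · exact hqp ▸ hLq
  · refine absurd (h.of_map_of_coprime_ker ?_) hR
    rw [QuotientGroup.ker_mk']
    exact coprime_card_of_isPGroup_of_ne Fact.out hq hLq hqp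

end IsMinimalNormal

namespace GroupClass

section Critical

variable {𝔉 : GroupClass.{u}} {π : Set Nat.Primes} {p : Nat.Primes} {G : Type u} [Group G]

theorem mem_piNilpotent_product_of_mem_piGroups_product [Finite G]
    (h : (formationProduct (piGroups {p}) 𝔉).Mem G) :
    (formationProduct (piNilpotent π) 𝔉).Mem G := by
  have : Fact (p : ℕ).Prime := ⟨p.2⟩
  have := (mem_piGroups_singleton_product_iff.1 h).isNilpotent
  refine mem_piNilpotent_product_iff.2 fun r _ => ?_
  have : Fact (r : ℕ).Prime := ⟨r.2⟩
  exact .of_isNilpotent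

namespace IsFormation

theorem isSCritical_quotient (h𝔉 : 𝔉.IsFormation)
    (hcrit : IsSCritical (formationProduct (piGroups {p}) 𝔉) G) {K : Subgroup G} [K.Normal]
    (hK : ¬ (formationProduct (piGroups {p}) 𝔉).Mem (G ⧸ K)) :
    IsSCritical (formationProduct (piGroups {p}) 𝔉) (G ⧸ K) := by
  have := hcrit.1
  have hsurj := QuotientGroup.mk'_surjective K
  refine h𝔉.isSCritical_of_surjective hsurj ?_ fun M hM =>
    (mem_piGroups_singleton_product_subgroup_iff.1 (hcrit.2.2 M hM)).map _
  rwa [h𝔉.map_residual _ hsurj, ← mem_piGroups_singleton_product_iff]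

theorem exists_isSCritical_forall_quotient_mem (h𝔉 : 𝔉.IsFormation) [Group.IsSolvable G]
    (hcrit : IsSCritical (formationProduct (piGroups {p}) 𝔉) G)
    (hG : ¬ (formationProduct (piNilpotent π) 𝔉).Mem G) :
    ∃ (H : Type u) (_ : Group H), Group.IsSolvable H ∧
      IsSCritical (formationProduct (piGroups {p}) 𝔉) H ∧
      ¬ (formationProduct (piNilpotent π) 𝔉).Mem H ∧
      ∀ (K : Subgroup H) [K.Normal], K ≠ ⊥ → (formationProduct (piNilpotent π) 𝔉).Mem (H ⧸ K) := by
  have := hcrit.1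
  induction hn : Nat.card G using Nat.strong_induction_on generalizing G with
  | _ n ih =>
  subst hn
  by_cases hquot : ∀ (K : Subgroup G) [K.Normal], K ≠ ⊥ →
      (formationProduct (piNilpotent π) 𝔉).Mem (G ⧸ K)
  · exact ⟨G, ‹_›, ‹_›, hcrit, hG, hquot⟩
  · push Not at hquot
    obtain ⟨K, _, hK, hGK⟩ := hquot
    exact ih _ (card_quotient_lt hK) (h𝔉.isSCritical_quotient hcrit
      (hGK ∘ mem_piNilpotent_product_of_mem_piGroups_product)) hGK inferInstance rfl

theorem isPGroup_map_residual_of_not_le_frattini (h𝔉 : 𝔉.IsFormation)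
    (hcrit : IsSCritical (formationProduct (piGroups {p}) 𝔉) G) {L : Subgroup G} [L.Normal]
    (hΦ : ¬ L ≤ frattini G) : IsPGroup p ((𝔉.residual G).map (QuotientGroup.mk' L)) := by
  by_contra hG
  have := hcrit.1
  refine hΦ ?_
  rw [← QuotientGroup.ker_mk' L]
  exact h𝔉.ker_le_frattini hG fun M hM =>
    (mem_piGroups_singleton_product_subgroup_iff.1 (hcrit.2.2 M hM)).map _

/-- Two distinct minimal normal subgroups would embed the residual in a product of two `p`-groups;
the unique one is an `r`-group, and `r ≠ p`. -/
theorem exists_coprime_card_forall_le (h𝔉 : 𝔉.IsFormation) [Group.IsSolvable G]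
    (hcrit : IsSCritical (formationProduct (piGroups {p}) 𝔉) G) {r : ℕ} [hr : Fact r.Prime]
    (hG : ¬ IsPNilpotent r (𝔉.residual G))
    (hquot : ∀ (K : Subgroup G) [K.Normal], K ≠ ⊥ →
      IsPNilpotent r ((𝔉.residual G).map (QuotientGroup.mk' K))) :
    ∃ L : Subgroup G, L.Normal ∧ L ≠ ⊥ ∧ (Nat.card L).Coprime p ∧
      ∀ (N : Subgroup G) [N.Normal], N ≠ ⊥ → L ≤ N := by
  have := hcrit.1
  have : Fact (p : ℕ).Prime := ⟨p.2⟩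
  have hR : ¬ IsPGroup p (𝔉.residual G) := fun h =>
    hcrit.2.1 (mem_piGroups_singleton_product_iff.2 h)
  have hmap (L : Subgroup G) [L.Normal] (hL : L ≠ ⊥) :
      IsPGroup p ((𝔉.residual G).map (QuotientGroup.mk' L)) :=
    h𝔉.isPGroup_map_residual_of_not_le_frattini hcrit fun hΦ =>
      hG (isPNilpotent_of_le_frattini hΦ (hquot L hL))
  obtain ⟨L, -, hL⟩ := exists_isMinimalNormal_le (N := 𝔉.residual G) fun h => hR (h ▸ .of_bot)
  have := hL.normal
  have hLr : IsPGroup r L := hL.isPGroup_of_not_isPNilpotent hG (hquot L hL.ne_bot)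
  have hrp : r ≠ p := by
    rintro rfl
    refine hR (((hmap L hL.ne_bot).comap_of_ker_isPGroup _ ?_).to_le (Subgroup.le_comap_map _ _))
    rwa [QuotientGroup.ker_mk']
  refine ⟨L, this, hL.ne_bot, coprime_card_of_isPGroup_of_ne p.2 hr.out hLr hrp, fun N _ hN => ?_⟩
  refine hL.inf_eq_bot_or_le.resolve_left fun h => hR ?_
  refine isPGroup_of_map_of_map (hmap N hN) (hmap L hL.ne_bot) ?_
  rwa [QuotientGroup.ker_mk', QuotientGroup.ker_mk']

theorem exists_faithful_irreducible_module (h𝔉 : 𝔉.IsFormation) [Group.IsSolvable G]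
    (hcrit : IsSCritical (formationProduct (piGroups {p}) 𝔉) G)
    (hG : ¬ (formationProduct (piNilpotent π) 𝔉).Mem G)
    (hquot : ∀ (K : Subgroup G) [K.Normal], K ≠ ⊥ →
      (formationProduct (piNilpotent π) 𝔉).Mem (G ⧸ K)) :
    ∃ (V : Type u) (_ : CommGroup V) (ψ : G →* MulAut V), Finite V ∧ IsPGroup p V ∧
      IsIrreducibleAction ψ ∧ Function.Injective ψ := by
  have := hcrit.1
  have : Fact (p : ℕ).Prime := ⟨p.2⟩
  obtain ⟨r, hr, hRr⟩ : ∃ r ∈ π, ¬ IsPNilpotent (r : ℕ) (𝔉.residual G) := by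
    by_contra! h
    exact hG (mem_piNilpotent_product_iff.2 h)
  have : Fact (r : ℕ).Prime := ⟨r.2⟩
  obtain ⟨L, _, hL, hLp, hLmin⟩ := h𝔉.exists_coprime_card_forall_le hcrit hRr fun K _ hK => by
    rw [h𝔉.map_residual _ (QuotientGroup.mk'_surjective K)]
    exact mem_piNilpotent_product_iff.1 (hquot K hK) r hr
  exact exists_isIrreducibleAction_injective hL hLp hLmin

end IsFormation

end Critical

section Semidirect

open SemidirectProduct

variable {𝔉 : GroupClass.{u}} {π : Set Nat.Primes} {p : Nat.Primes} {G V : Type u} [Group G]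
  [Group V] {ψ : G →* MulAut V}

theorem IsFormation.piNormInfty_eq_bot (h𝔉 : 𝔉.IsFormation) [Finite G] (h : piNorm 𝔉 π G = ⊥) :
    piNormInfty 𝔉 π G = ⊥ := by
  have hstep (D : Subgroup G) [D.Normal] (hD : D = ⊥) :
      (piNorm 𝔉 π (G ⧸ D)).comap (QuotientGroup.mk' D) = ⊥ := by
    rw [← le_bot_iff, ← h]
    exact h𝔉.comap_piNorm_le _ ((MonoidHom.ker_eq_bot_iff _).1 ((QuotientGroup.ker_mk' D).trans hD))
  refine iSup_eq_bot.2 fun i => ?_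
  induction i with
  | zero => rfl
  | succ i ih => exact hstep _ ih

/-- A subgroup `U ∈ 𝔑_π ∘ 𝔉` does not cover `G`, so the residual of its image in the critical group
`G` is a `p`-group, and so is the residual of `UV`. -/
theorem IsFormation.range_inl_le_intMaximal (h𝔉 : 𝔉.IsFormation) [Finite V] [Finite G]
    (hV : IsPGroup (p : ℕ) V) (hcrit : IsSCritical (formationProduct (piGroups {p}) 𝔉) G)
    (hG : ¬ (formationProduct (piNilpotent π) 𝔉).Mem G) :
    (inl : V →* V ⋊[ψ] G).range ≤
      intMaximal (formationProduct (piNilpotent π) 𝔉) (V ⋊[ψ] G) := by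
  refine le_intMaximal fun U hU => ?_
  have hlt : U.map rightHom < ⊤ := by
    refine lt_top_iff_ne_top.2 fun h => hG (mem_piNilpotent_product_iff.2 fun r hr => ?_)
    have : Fact (r : ℕ).Prime := ⟨r.2⟩
    rw [← h𝔉.subgroupResidual_top, ← h, h𝔉.subgroupResidual_map]
    exact (mem_piNilpotent_product_subgroup_iff.1 hU r hr).map _
  have hUp := mem_piGroups_singleton_product_subgroup_iff.1 (hcrit.2.2 _ hlt)
  have hmap : (U ⊔ (inl : V →* V ⋊[ψ] G).range).map rightHom = U.map rightHom := by
    rw [Subgroup.map_sup, range_inl_eq_ker_rightHom, Subgroup.map_ker_self, sup_bot_eq]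
  rw [← hmap, h𝔉.subgroupResidual_map] at hUp
  refine mem_piNilpotent_product_of_mem_piGroups_product (p := p)
    (mem_piGroups_singleton_product_subgroup_iff.2 ?_)
  refine (hUp.comap_of_ker_isPGroup rightHom ?_).to_le (Subgroup.le_comap_map _ _)
  rw [← range_inl_eq_ker_rightHom]
  exact hV.of_surjective _ inl.rangeRestrict_surjective

theorem piRadical_semidirectProduct_eq_bot [Finite V] [Finite G] [IsMulCommutative V]
    (hp : p ∈ π) (hV : IsPGroup (p : ℕ) V) (hψ : IsIrreducibleAction ψ)
    (hinj : Function.Injective ψ) : piRadical πᶜ (V ⋊[ψ] G) = ⊥ := by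
  have : Fact (p : ℕ).Prime := ⟨p.2⟩
  have := hψ.nontrivial
  by_contra hne
  have hle := hψ.range_inl_le hinj hne
  refine hψ.isMinimalNormal_range_inl.ne_bot ((Subgroup.eq_bot_iff_forall _).2 fun x hx => ?_)
  refine eq_one_of_isPGroup_of_coprime (hV.of_surjective _ inl.rangeRestrict_surjective) hx
    (Nat.Coprime.coprime_dvd_left (Subgroup.orderOf_dvd_natCard _ (hle hx)) ?_)
  exact coprime_card_of_mem_piGroups mem_piGroups_piRadical (Set.notMem_compl_iff.2 hp)

theorem IsFormation.not_range_inl_le_piNormInfty (h𝔉 : 𝔉.IsFormation) [Finite V] [Finite G]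
    [IsMulCommutative V] (hp : p ∈ π) (hV : IsPGroup (p : ℕ) V) (hψ : IsIrreducibleAction ψ)
    (hinj : Function.Injective ψ) (hG : 𝔉.residual G ≠ ⊥) :
    ¬ (inl : V →* V ⋊[ψ] G).range ≤ piNormInfty 𝔉 πᶜ (V ⋊[ψ] G) := by
  intro hle
  have hnorm : piNorm 𝔉 πᶜ (V ⋊[ψ] G) ≠ ⊥ := fun h =>
    hψ.isMinimalNormal_range_inl.ne_bot (le_bot_iff.1 (hle.trans (h𝔉.piNormInfty_eq_bot h).le))
  have hcomm := commutator_subgroupResidual_eq_bot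
    (piRadical_semidirectProduct_eq_bot hp hV hψ hinj) (hψ.range_inl_le hinj hnorm)
    disjoint_range_inr_range_inl
  rw [h𝔉.subgroupResidual_range, Subgroup.commutator_eq_bot_iff_le_centralizer,
    centralizer_range_inl hinj] at hcomm
  refine hG ((Subgroup.map_eq_bot_iff_of_injective _ (inr_injective (φ := ψ))).1 (le_bot_iff.1 ?_))
  exact disjoint_range_inr_range_inl (Subgroup.map_le_range _ _) hcomm

theorem IsFormation.exists_not_intMaximal_le_piNormInfty (h𝔉 : 𝔉.IsFormation) (hp : p ∈ π)
    (hcrit : IsSCritical (formationProduct (piGroups {p}) 𝔉) G) [Group.IsSolvable G]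
    (hG : ¬ (formationProduct (piNilpotent π) 𝔉).Mem G) :
    ∃ (T : Type u) (_ : Group T), solvable.Mem T ∧
      ¬ intMaximal (formationProduct (piNilpotent π) 𝔉) T ≤ piNormInfty 𝔉 πᶜ T := by
  obtain ⟨H, _, _, hcritH, hH, hquot⟩ := h𝔉.exists_isSCritical_forall_quotient_mem hcrit hG
  obtain ⟨V, _, ψ, _, hV, hψ, hinj⟩ := h𝔉.exists_faithful_irreducible_module hcritH hH hquot
  have := hcritH.1
  have hR : 𝔉.residual H ≠ ⊥ := fun h =>
    hcritH.2.1 (mem_piGroups_singleton_product_iff.2 (h ▸ .of_bot))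
  have : Group.IsSolvable (V ⋊[ψ] H) :=
    Group.isSolvable_of_ker_le_range inl rightHom range_inl_eq_ker_rightHom.ge
  exact ⟨V ⋊[ψ] H, inferInstance, ⟨inferInstance, inferInstance⟩, fun hle =>
    h𝔉.not_range_inl_le_piNormInfty hp hV hψ hinj hR
      ((h𝔉.range_inl_le_intMaximal hV hcritH hH).trans hle)⟩

end Semidirect

end GroupClass

theorem theoremE (𝔉 : GroupClass.{u}) (h𝔉 : 𝔉.IsFormation) (hS : 𝔉.IsSubgroupClosed)
    (π : Set Nat.Primes) :
    List.TFAE [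
      ∀ (G : Type u) [Group G], GroupClass.solvable.Mem G →
        GroupClass.piNormInfty 𝔉 πᶜ G =
          GroupClass.intMaximal (GroupClass.formationProduct (GroupClass.piNilpotent π) 𝔉) G,
      ∀ (G : Type u) [Group G], GroupClass.solvable.Mem G →
        GroupClass.piHypercentre (GroupClass.formationProduct GroupClass.nilpotent 𝔉) π G =
          GroupClass.intMaximal (GroupClass.formationProduct (GroupClass.piNilpotent π) 𝔉) G,
      GroupClass.BoundaryConditionIIISolvable 𝔉 π] := by
  tfae_have 2 → 1 := by
    rintro h G _ ⟨_, _⟩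
    exact le_antisymm h𝔉.piNormInfty_le_intMaximal
      ((h G ⟨‹_›, ‹_›⟩).ge.trans (h𝔉.piHypercentre_le_piNormInfty hS))
  tfae_have 1 → 3 := by
    intro h p hp G _ hcrit ⟨_, _⟩
    by_contra hG
    obtain ⟨T, _, hT, hlt⟩ := h𝔉.exists_not_intMaximal_le_piNormInfty hp hcrit hG
    exact hlt (h T hT).ge
  tfae_have 3 → 2 := by
    rintro h G _ ⟨_, _⟩
    exact le_antisymm ((h𝔉.piHypercentre_le_piNormInfty hS).trans h𝔉.piNormInfty_le_intMaximal)
      (le_sSup (h𝔉.isPiHypercentral_intMaximal hS h))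
  tfae_finish
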